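/- Let $m,N\ge 1$ and let $A=(a_{ji})$ be a random $m\times N$ matrix with independent entries distributed as a real random variable $X$ that is symmetric ($X$ and $-X$ have the same law) and has variance one. Write $B_p^n=\{x\in\mathbb R^n:\|x\|_p\le 1\}$ for the unit ball of the $\ell_p$-norm and $AB_1^N=\{Au:u\in B_1^N\}\subset\mathbb R^m$ for the absolutely convex hull of the columns of $A$. For a mean-zero, unit-variance random variable $X$: $X$ fulfills the weak moment assumption of order $k$ with constants $\kappa_1>0$ and $\gamma\ge 1/2$ if $(\mathbb E|X|^p)^{1/p}\le\kappa_1p^\gamma$ for all real $p$ with $4\le p\le k$; and $X$ is super-Gaussian with parameter $\sigma>0$ if $\mathbb P(|\sigma g|>t)\le\mathbb P(|X|>t)$ for all $t>0$, where $g$ is a standard normal variable. (a) There is an absolute constant $c_0>0$ such that for all $\kappa_1>0$ and $\gamma\ge1/2$ there are constants $\widetilde C,D>0$, depending only on $\kappa_1$ and $\gamma$, with the following property. If $X$ fulfills the weak moment assumption of order $\max\{4,\log m\}$ with constants $\kappa_1$ and $\gamma$, if $4e^{4\gamma}c_0^2\kappa_1^2\log m\le m$, and if $N\ge\max\{\widetilde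 Cm,(\log m)^{2\gamma-1}\}$, then $$\mathbb P\Big(AB_1^N\supset\tfrac1D\big(\sqrt{\log(eN/m)}\,B_2^m\cap B_\infty^m\big)\Big)\ge1-2e^{-2m}.$$ (b) For every $0<\sigma\le1$ there are constants $\widetilde C,D>0$, depending only on $\sigma$, such that, if $X$ is super-Gaussian with parameter $\sigma$ and $N\ge\widetilde Cm$, then $$\mathbb P\Big(AB_1^N\supset\tfrac1D\sqrt{\log(eN/m)}\,B_2^m\Big)\ge1-2e^{-2m}.$$ -/

import Mathlib

open MeasureTheory ProbabilityTheory
open scoped ENNReal Matrix Pointwise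

universe u v

/-- `B_p^n`, the closed unit ball of the `ℓ_p`-norm on `ℝⁿ`. -/
def lpUnitBall (p : ℝ≥0∞) (n : ℕ) : Set (Fin n → ℝ) :=
  {x | ‖WithLp.toLp p x‖ ≤ 1}

/-- `A B_1^N`, the image of the `ℓ_1`-unit ball under the matrix `A`, that is, the absolutely
convex hull of the columns of `A`. -/
def columnPolytope {m N : ℕ} (A : Matrix (Fin m) (Fin N) ℝ) : Set (Fin m → ℝ) :=
  (fun x => A *ᵥ x) '' lpUnitBall 1 N

/-- A real random variable with mean zero and variance one. -/
structure IsStandardized {Ω : Type*} [MeasurableSpace Ω] (X : Ω → ℝ) (P : Measure Ω) : Prop where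
  memLp : MemLp X 2 P
  mean_zero : ∫ ω, X ω ∂P = 0
  unit_variance : variance X P = 1

/-- A random variable that is symmetric (`X` and `-X` have the same law) and has variance one. -/
structure IsSymmetricUnitVariance {Ω : Type*} [MeasurableSpace Ω] (X : Ω → ℝ)
    (P : Measure Ω) : Prop where
  symmetric : IdentDistrib X (fun ω => -X ω) P P
  memLp : MemLp X 2 P
  unit_variance : variance X P = 1

/-- `X` has mean zero and variance one and `ℙ(|σ g| > t) ≤ ℙ(|X| > t)` for all `t > 0`, where
`g` is a standard normal variable. -/
structure IsSuperGaussian {Ω : Type*} [MeasurableSpace Ω] (X : Ω → ℝ) (σ : ℝ)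
    (P : Measure Ω) : Prop where
  standardized : IsStandardized X P
  parameter_pos : 0 < σ
  tail_le : ∀ t : ℝ, 0 < t → gaussianReal 0 1 {x : ℝ | t < |σ * x|} ≤ P {ω | t < |X ω|}

/-- The weak moment assumption of order `k` with constants `κ₁` and `γ ≥ 1/2`: `X` has mean zero
and variance one and `‖X‖_{L_p} ≤ κ₁ p^γ` for all real `p` with `4 ≤ p ≤ k`. -/
structure WeakMomentAssumption {Ω : Type*} [MeasurableSpace Ω] (X : Ω → ℝ) (k κ₁ γ : ℝ)
    (P : Measure Ω) : Prop where
  standardized : IsStandardized X P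
  half_le : 1 / 2 ≤ γ
  moment_le : ∀ p : ℝ, 4 ≤ p → p ≤ k →
    eLpNorm X (ENNReal.ofReal p) P ≤ ENNReal.ofReal (κ₁ * p ^ γ)

/-- `A` is a random matrix whose entries are independent copies of the symmetric unit variance
random variable `X`. -/
structure IsIIDSymmetricMatrix {Ω Ω' : Type*} [MeasurableSpace Ω] [MeasurableSpace Ω'] {m N : ℕ}
    (A : Ω → Matrix (Fin m) (Fin N) ℝ) (μ : Measure Ω) (X : Ω' → ℝ) (P : Measure Ω') :
    Prop where
  indep : iIndepFun (fun (e : Fin m × Fin N) ω => A ω e.1 e.2) μ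
  identDistrib : ∀ j i, IdentDistrib (fun ω => A ω j i) X μ P
  symmetric_unit_variance : IsSymmetricUnitVariance X P

/-!
By separation, `D⁻¹ K` fails to lie in `A B₁ᴺ` exactly when some `z` satisfies `|⟨Aᵢ, z⟩| ≤ 1` for
all columns `Aᵢ` while `⟨x, z⟩ > D` for some `x ∈ K`. The set of those `z` with `⟨x, z⟩ ≤ D` on `K`
is closed and convex, so by Krein-Milman the vector `z` can be taken to be a vertex of the
polyhedron of the constraints, once the harmless vectors `eⱼ / (2 D)` have been added to the columns
to make that polyhedron bounded (`exists_vertex_of_not_subset_columnPolytope`). A vertex is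
determined by `m` linearly independent active constraints and their signs. This leaves
`(N + m).choose m * 2 ^ m` candidates, each a measurable function of at most `m` columns, and
conditionally on these the other columns are independent of the candidate. If every `z` with
`⟨x, z⟩ > D` for some `x ∈ K` satisfies `ℙ(⟨Y, z⟩ > 1) ≥ p` for a random column `Y`, the failure
probability is therefore at most `(N + m).choose m * 2 ^ m * (1 - p) ^ (N - m)`
(`measure_not_subset_columnPolytope_le`).

With `L = log (e N / m)` the required value is `p = β exp (-L / 2)`, of order `√(m / N)`; then `p N`
dominates `m L` as soon as `N / m` is large (`choose_mul_two_pow_mul_le`). The tail bound is of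
Montgomery-Smith type (`exp_le_measureReal_linear_form`). Given `x ∈ K`, so that `∑ xⱼ² ≤ L`, the
coordinates are grouped greedily into at most about `L / R` blocks, each carrying mass between `R`
and `2 R` of `x`. On each block `I` the sum `∑ zⱼ Yⱼ` exceeds a multiple of the norm of `z` on `I`
with probability at least `β` (Paley-Zygmund after truncation, `small_ball_block`), and by
Cauchy-Schwarz this norm controls the contribution of the block to `⟨x, z⟩`. The blocks are
independent, so all these events occur together with probability at least `β exp (-L / 2)`.

Blocks need only a bound `ℙ(|X| ≥ τ) ≥ q` with positive constants: in part (a) this follows from the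
fourth moment, in part (b) from the Gaussian lower tail. Single coordinates with `xⱼ² > R` occur
only in part (b), where `K` is a Euclidean ball, and there the Gaussian lower tail handles each of
them with probability at least `exp (-xⱼ² / 2)`.
-/

/-! ### Separation and vertices of the polar polyhedron -/

lemma isCompact_lpUnitBall (p : ℝ≥0∞) [Fact (1 ≤ p)] (n : ℕ) : IsCompact (lpUnitBall p n) := by
  have h : lpUnitBall p n =
      WithLp.ofLp '' (Metric.closedBall (0 : WithLp p (Fin n → ℝ)) 1) := by
    ext x
    simp only [lpUnitBall, Set.mem_ofPred_eq, Set.mem_image, mem_closedBall_zero_iff]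
    constructor
    · intro hx
      exact ⟨WithLp.toLp p x, hx, rfl⟩
    · rintro ⟨y, hy, rfl⟩
      exact hy
  rw [h]
  exact (isCompact_closedBall _ _).image (PiLp.continuous_ofLp p _)

lemma convex_lpUnitBall (p : ℝ≥0∞) [Fact (1 ≤ p)] (n : ℕ) : Convex ℝ (lpUnitBall p n) := by
  have h : lpUnitBall p n = (WithLp.linearEquiv p ℝ (Fin n → ℝ)).symm.toLinearMap ⁻¹'
      (Metric.closedBall (0 : WithLp p (Fin n → ℝ)) 1) := by
    ext x
    simp [lpUnitBall]
  rw [h]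
  exact (convex_closedBall _ _).linear_preimage _

lemma isCompact_columnPolytope {m N : ℕ} (A : Matrix (Fin m) (Fin N) ℝ) :
    IsCompact (columnPolytope A) :=
  (isCompact_lpUnitBall 1 N).image (continuous_const.matrix_mulVec continuous_id)

lemma convex_columnPolytope {m N : ℕ} (A : Matrix (Fin m) (Fin N) ℝ) :
    Convex ℝ (columnPolytope A) :=
  (convex_lpUnitBall 1 N).is_linear_image A.mulVecLin.isLinear

lemma smul_column_mem_columnPolytope {m N : ℕ} (A : Matrix (Fin m) (Fin N) ℝ) (i : Fin N) (c : ℝ)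
    (hc : |c| ≤ 1) : c • A.col i ∈ columnPolytope A := by
  refine ⟨Pi.single i c, ?_, ?_⟩
  · have := PiLp.norm_single (p := 1) (β := fun _ : Fin N => ℝ) i c
    simpa [lpUnitBall, PiLp.toLp_single] using hc
  · ext j
    simp [mul_comm]

lemma exists_dotProduct_of_not_subset_columnPolytope {m N : ℕ} (A : Matrix (Fin m) (Fin N) ℝ)
    {K : Set (Fin m → ℝ)} {D : ℝ} (hD : 0 < D) (h : ¬ D⁻¹ • K ⊆ columnPolytope A) :
    ∃ z : Fin m → ℝ, (∃ x ∈ K, D < x ⬝ᵥ z) ∧ ∀ i, |A.col i ⬝ᵥ z| ≤ 1 := by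
  obtain ⟨y, hyK, hy⟩ := Set.not_subset.1 h
  obtain ⟨x, hxK, rfl⟩ := hyK
  obtain ⟨f, u, hfu, hux⟩ := geometric_hahn_banach_closed_point
    (convex_columnPolytope A) (isCompact_columnPolytope A).isClosed hy
  obtain ⟨w, hw⟩ := (dotProductEquiv ℝ (Fin m)).surjective f.toLinearMap
  have hfw : ∀ v, f v = v ⬝ᵥ w := fun v => by
    rw [dotProduct_comm]
    exact (LinearMap.congr_fun hw v).symm
  have hu : 0 < u := by
    simpa using hfu 0 ⟨0, by simp [lpUnitBall], by simp⟩
  refine ⟨u⁻¹ • w, ⟨x, hxK, ?_⟩, fun i => ?_⟩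
  · rw [hfw] at hux
    simp only [smul_dotProduct, smul_eq_mul, dotProduct_smul] at hux ⊢
    rw [lt_inv_mul_iff₀ hD] at hux
    rw [lt_inv_mul_iff₀ hu]
    linarith
  · have h1 := hfu _ (smul_column_mem_columnPolytope A i 1 (by simp))
    have h2 := hfu _ (smul_column_mem_columnPolytope A i (-1) (by simp))
    rw [hfw] at h1 h2
    simp only [smul_dotProduct, smul_eq_mul, dotProduct_smul] at h1 h2 ⊢
    rw [abs_mul, abs_of_pos (inv_pos.2 hu), inv_mul_le_iff₀ hu, abs_le]
    constructor <;> linarith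

/-- The polyhedron cut out by the constraints `|⟨v k, z⟩| ≤ 1`. -/
def symmetricPolyhedron {ι : Type*} {m : ℕ} (v : ι → Fin m → ℝ) : Set (Fin m → ℝ) :=
  {z | ∀ k, |v k ⬝ᵥ z| ≤ 1}

lemma isClosed_symmetricPolyhedron {ι : Type*} {m : ℕ} (v : ι → Fin m → ℝ) :
    IsClosed (symmetricPolyhedron v) := by
  simp only [symmetricPolyhedron, Set.ofPred_forall]
  exact isClosed_iInter fun k => isClosed_le
    (continuous_const.dotProduct continuous_id).abs continuous_const

lemma convex_symmetricPolyhedron {ι : Type*} {m : ℕ} (v : ι → Fin m → ℝ) :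
    Convex ℝ (symmetricPolyhedron v) := by
  intro x hx y hy a b ha hb hab k
  rw [dotProduct_add, dotProduct_smul, dotProduct_smul, smul_eq_mul, smul_eq_mul]
  have h1 := abs_le.1 (hx k)
  have h2 := abs_le.1 (hy k)
  rw [abs_le]
  constructor <;> nlinarith

/-- The active constraints at an extreme point span the space: a vector `w` orthogonal to all of
them would make the point the midpoint of a segment in direction `w`. -/
lemma span_active_eq_top_of_mem_extremePoints {ι : Type*} [Finite ι] {m : ℕ}
    {v : ι → Fin m → ℝ} {z : Fin m → ℝ}
    (hz : z ∈ (symmetricPolyhedron v).extremePoints ℝ) :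
    Submodule.span ℝ (Set.range fun k : {k // |v k ⬝ᵥ z| = 1} => v k) = ⊤ := by
  by_contra hne
  obtain ⟨f, hf0, hf⟩ := Submodule.exists_le_ker_of_lt_top _ (lt_top_iff_ne_top.2 hne)
  obtain ⟨w, rfl⟩ := (dotProductEquiv ℝ (Fin m)).surjective f
  have hw0 : w ≠ 0 := by
    rintro rfl
    simp at hf0
  have hwk : ∀ k, |v k ⬝ᵥ z| = 1 → v k ⬝ᵥ w = 0 := fun k hk => by
    have := hf (Submodule.subset_span ⟨⟨k, hk⟩, rfl⟩)
    rw [dotProduct_comm]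
    simpa using this
  have hmem := mem_extremePoints.1 hz
  -- A short enough step in direction `±w` stays inside every inactive constraint.
  have hstep : ∀ᶠ t : ℝ in nhds 0, ∀ k, |v k ⬝ᵥ (z + t • w)| ≤ 1 := by
    rw [Filter.eventually_all]
    intro k
    by_cases hk : |v k ⬝ᵥ z| = 1
    · refine Filter.Eventually.of_forall fun t => ?_
      rw [dotProduct_add, dotProduct_smul, hwk k hk, smul_zero, add_zero]
      exact hk.le
    · have hlt : |v k ⬝ᵥ z| < 1 := lt_of_le_of_ne (hmem.1 k) hk
      have hc : Continuous fun t : ℝ => |v k ⬝ᵥ (z + t • w)| :=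
        (continuous_const.dotProduct
          (continuous_const.add (continuous_id.smul continuous_const))).abs
      have := (hc.tendsto 0).eventually (gt_mem_nhds (by simpa using hlt))
      exact this.mono fun t ht => ht.le
  have hstep' : ∀ᶠ t : ℝ in nhds 0, ∀ k, |v k ⬝ᵥ (z + (-t) • w)| ≤ 1 := by
    have hn : Filter.Tendsto (fun t : ℝ => -t) (nhds 0) (nhds 0) := by
      simpa using (continuous_neg (G := ℝ)).tendsto 0
    exact hn.eventually hstep
  obtain ⟨t, ⟨h1, h2⟩, ht⟩ :=
    ((hstep.and hstep').filter_mono nhdsWithin_le_nhds |>.and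
      (self_mem_nhdsWithin (s := Set.Ioi (0 : ℝ)))).exists
  have hseg : z ∈ openSegment ℝ (z + t • w) (z + (-t) • w) :=
    ⟨1 / 2, 1 / 2, by norm_num, by norm_num, by norm_num, by
      ext i
      simp
      ring⟩
  have := hmem.2 _ h1 _ h2 hseg
  have h3 : t • w = 0 := by simpa using this.1
  rcases smul_eq_zero.1 h3 with h | h
  · exact (ne_of_gt ht) h
  · exact hw0 h

/-- If the bounded polyhedron `|⟨v k, z⟩| ≤ 1` leaves a closed convex set `C`, then one of its
vertices does; a vertex is determined by `m` linearly independent active constraints. -/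
lemma exists_vertex_notMem {ι : Type*} [Finite ι] {m : ℕ} {v : ι → Fin m → ℝ}
    (hb : Bornology.IsBounded (symmetricPolyhedron v)) {C : Set (Fin m → ℝ)} (hC : Convex ℝ C)
    (hCc : IsClosed C) (h : ¬ symmetricPolyhedron v ⊆ C) :
    ∃ z ∈ symmetricPolyhedron v, z ∉ C ∧ ∃ S : Finset ι, S.card = m ∧
      LinearIndependent ℝ (fun k : S => v k) ∧ ∀ k ∈ S, |v k ⬝ᵥ z| = 1 := by
  classical
  have hcomp : IsCompact (symmetricPolyhedron v) :=
    Metric.isCompact_of_isClosed_isBounded (isClosed_symmetricPolyhedron v) hb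
  have hext : ¬ (symmetricPolyhedron v).extremePoints ℝ ⊆ C := by
    intro hsub
    apply h
    rw [← closure_convexHull_extremePoints hcomp (convex_symmetricPolyhedron v)]
    exact closure_minimal (convexHull_min hsub hC) hCc
  obtain ⟨z, hz, hzC⟩ := Set.not_subset.1 hext
  refine ⟨z, extremePoints_subset hz, hzC, ?_⟩
  have hspan := span_active_eq_top_of_mem_extremePoints hz
  obtain ⟨κ, a, ha, hsp, hli⟩ :=
    exists_linearIndependent' ℝ (fun k : {k // |v k ⬝ᵥ z| = 1} => v k)
  rw [hspan] at hsp
  have : Finite κ := Finite.of_injective a ha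
  have := Fintype.ofFinite κ
  have hcard : Fintype.card κ = m := by
    have := Module.finrank_eq_card_basis (Module.Basis.mk hli hsp.ge)
    simpa using this.symm
  have hinj : Function.Injective fun x : κ => (a x : ι) := Subtype.val_injective.comp ha
  refine ⟨Finset.univ.map ⟨_, hinj⟩, by simpa using hcard, ?_, ?_⟩
  · have h1 : LinearIndependent ℝ (fun x : κ => v (a x : ι)) := hli
    let e : κ ≃ (Finset.univ.map ⟨fun x : κ => (a x : ι), hinj⟩ : Finset ι) :=
      Equiv.ofBijective (fun x => ⟨a x, by simp⟩) ⟨fun x y hxy => hinj (by simpa using hxy), by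
        rintro ⟨k, hk⟩
        obtain ⟨x, -, hx⟩ := Finset.mem_map.1 hk
        exact ⟨x, Subtype.ext hx⟩⟩
    exact (linearIndependent_equiv' e (g := fun x : κ => v (a x : ι)) rfl).1 h1
  · intro k hk
    obtain ⟨x, -, hx⟩ := Finset.mem_map.1 hk
    rw [← hx]
    exact (a x).2

/-- The columns of `A` together with the vectors `δ eⱼ`; the latter make the polyhedron of all
constraints bounded. -/
def augmentedColumns {m N : ℕ} (δ : ℝ) (A : Fin N → Fin m → ℝ) : Fin N ⊕ Fin m → Fin m → ℝ :=
  Sum.elim A (fun j => Pi.single j δ)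

lemma isBounded_symmetricPolyhedron_augmentedColumns {m N : ℕ} {δ : ℝ} (hδ : 0 < δ)
    (A : Fin N → Fin m → ℝ) :
    Bornology.IsBounded (symmetricPolyhedron (augmentedColumns δ A)) := by
  refine (Metric.isBounded_closedBall (x := (0 : Fin m → ℝ)) (r := δ⁻¹)).subset fun z hz => ?_
  rw [mem_closedBall_zero_iff, pi_norm_le_iff_of_nonneg (inv_nonneg.2 hδ.le)]
  intro j
  have := hz (Sum.inr j)
  simp only [augmentedColumns, Sum.elim_inr, single_dotProduct, abs_mul, abs_of_pos hδ] at this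
  rw [Real.norm_eq_abs, ← one_div, le_div_iff₀ hδ]
  linarith

/-- If `D⁻¹ K` is not contained in the polytope, then this is witnessed by a vertex `z` of the
polyhedron of all augmented constraints. -/
lemma exists_vertex_of_not_subset_columnPolytope {m N : ℕ} (A : Matrix (Fin m) (Fin N) ℝ)
    {K : Set (Fin m → ℝ)} {D : ℝ} (hD : 0 < D)
    (hK : ∀ (j : Fin m) (c : ℝ), |c| = 1 → Pi.single j c ∈ K)
    (h : ¬ D⁻¹ • K ⊆ columnPolytope A) :
    ∃ S : Finset (Fin N ⊕ Fin m), S.card = m ∧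
      LinearIndependent ℝ (fun k : S => augmentedColumns (2 * D)⁻¹ A.col k) ∧
      ∃ z : Fin m → ℝ, (∃ x ∈ K, D < x ⬝ᵥ z) ∧ (∀ i, |A.col i ⬝ᵥ z| ≤ 1) ∧
        ∀ k ∈ S, |augmentedColumns (2 * D)⁻¹ A.col k ⬝ᵥ z| = 1 := by
  have hδ : (0 : ℝ) < (2 * D)⁻¹ := by positivity
  set C : Set (Fin m → ℝ) := {z | ∀ x ∈ K, x ⬝ᵥ z ≤ D} with hCdef
  have hC : Convex ℝ C := by
    intro y hy z hz a b ha hb hab x hx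
    rw [dotProduct_add, dotProduct_smul, dotProduct_smul, smul_eq_mul, smul_eq_mul]
    have h1 := hy x hx
    have h2 := hz x hx
    have h3 := mul_le_mul_of_nonneg_left h1 ha
    have h4 := mul_le_mul_of_nonneg_left h2 hb
    have h5 : a * D + b * D = D := by rw [← add_mul, hab, one_mul]
    linarith
  have hCc : IsClosed C := by
    simp only [hCdef, Set.ofPred_forall]
    exact isClosed_iInter fun x => isClosed_iInter fun _ => isClosed_le
      (continuous_const.dotProduct continuous_id) continuous_const
  have hout : ¬ symmetricPolyhedron (augmentedColumns (2 * D)⁻¹ A.col) ⊆ C := by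
    obtain ⟨z, ⟨x, hxK, hx⟩, hz⟩ := exists_dotProduct_of_not_subset_columnPolytope A hD h
    rw [Set.not_subset]
    by_cases hn : ‖z‖ ≤ 2 * D
    · refine ⟨z, ?_, fun hzC => absurd (hzC x hxK) (not_le.2 hx)⟩
      rintro (i | j)
      · exact hz i
      · simp only [augmentedColumns, Sum.elim_inr, single_dotProduct, abs_mul, abs_of_pos hδ]
        rw [inv_mul_le_iff₀ (by positivity), mul_one]
        exact (norm_le_pi_norm z j).trans hn
    · -- Shrink `z` to sup norm `2 * D`; a unit vector of `K` then still gives a value above `D`.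
      push Not at hn
      have hz0 : 0 < ‖z‖ := lt_trans (by positivity) hn
      set s : ℝ := 2 * D / ‖z‖ with hs
      have hs0 : 0 < s := by positivity
      have hs1 : s ≤ 1 := (div_le_one hz0).2 hn.le
      refine ⟨s • z, ?_, fun hzC => ?_⟩
      · rintro (i | j)
        · rw [dotProduct_smul, smul_eq_mul, abs_mul, abs_of_pos hs0]
          exact mul_le_one₀ hs1 (abs_nonneg _) (hz i)
        · simp only [augmentedColumns, Sum.elim_inr, single_dotProduct, abs_mul, abs_of_pos hδ,
            Pi.smul_apply, smul_eq_mul, abs_of_pos hs0]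
          rw [inv_mul_le_iff₀ (by positivity), mul_one, hs, div_mul_eq_mul_div, div_le_iff₀ hz0]
          exact mul_le_mul_of_nonneg_left (norm_le_pi_norm z j) (by positivity)
      · have hle : ‖s • z‖ ≤ D := by
          rw [pi_norm_le_iff_of_nonneg hD.le]
          intro j
          rw [Real.norm_eq_abs, abs_le]
          have h1 := hzC _ (hK j 1 (by simp))
          have h2 := hzC _ (hK j (-1) (by simp))
          rw [single_dotProduct] at h1 h2
          constructor <;> linarith
        rw [norm_smul, Real.norm_eq_abs, abs_of_pos hs0, hs, div_mul_cancel₀ _ hz0.ne'] at hle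
        linarith
  obtain ⟨z, hz, hzC, S, hS, hli, hact⟩ := exists_vertex_notMem
    (isBounded_symmetricPolyhedron_augmentedColumns hδ A.col) hC hCc hout
  refine ⟨S, hS, hli, z, ?_, fun i => hz (Sum.inl i), hact⟩
  simpa [hCdef] using hzC

/-! ### Lower tail bounds for linear forms -/

/-- The Paley-Zygmund inequality at level one half. -/
lemma paley_zygmund_half {Ω : Type*} [MeasurableSpace Ω] {μ : Measure Ω} [IsProbabilityMeasure μ]
    {Z : Ω → ℝ} (hZ : Integrable Z μ) (hZ2 : Integrable (fun ω => Z ω ^ 2) μ)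
    {v C : ℝ} (hv : 0 < v) (hC : 0 < C) (h1 : ∫ ω, Z ω ∂μ = v)
    (h2 : ∫ ω, Z ω ^ 2 ∂μ ≤ C * v ^ 2) :
    1 / (4 * C) ≤ μ.real {ω | v / 2 ≤ Z ω} := by
  have hms : NullMeasurableSet {ω | v / 2 ≤ Z ω} μ :=
    nullMeasurableSet_le aemeasurable_const hZ.aemeasurable
  have hind : Integrable ({ω | v / 2 ≤ Z ω}.indicator fun _ => C * v) μ :=
    (integrable_const _).indicator₀ hms
  have hpt : ∀ ω, Z ω ≤
      v / 2 + 1 / (4 * C * v) * Z ω ^ 2 + {ω | v / 2 ≤ Z ω}.indicator (fun _ => C * v) ω := by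
    intro ω
    have hsq : 0 ≤ 1 / (4 * C * v) * Z ω ^ 2 := by positivity
    by_cases hω : v / 2 ≤ Z ω
    · rw [Set.indicator_of_mem (by exact hω)]
      have : 1 / (4 * C * v) * Z ω ^ 2 + C * v - Z ω =
          1 / (4 * C * v) * (Z ω - 2 * C * v) ^ 2 := by
        field_simp
        ring
      have h3 : 0 ≤ 1 / (4 * C * v) * (Z ω - 2 * C * v) ^ 2 := by positivity
      linarith
    · rw [Set.indicator_of_notMem (by exact hω)]
      push Not at hω
      linarith
  have hq : Integrable (fun ω => v / 2 + 1 / (4 * C * v) * Z ω ^ 2) μ :=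
    (integrable_const _).add (hZ2.const_mul _)
  have hint := integral_mono hZ (hq.add hind) hpt
  simp only [Pi.add_apply] at hint
  rw [integral_add hq hind, integral_add (integrable_const _) (hZ2.const_mul _), integral_const_mul, h1,
    integral_indicator₀ hms] at hint
  simp only [integral_const, probReal_univ, smul_eq_mul, one_mul, measureReal_restrict_apply_univ]
    at hint
  have h4 : 1 / (4 * C * v) * ∫ ω, Z ω ^ 2 ∂μ ≤ 1 / (4 * C * v) * (C * v ^ 2) :=
    mul_le_mul_of_nonneg_left h2 (by positivity)
  have h5 : 1 / (4 * C * v) * (C * v ^ 2) = v / 4 := by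
    field_simp
  have h6 : v / 4 ≤ μ.real {ω | v / 2 ≤ Z ω} * (C * v) := by linarith
  rw [div_le_iff₀ (by positivity)]
  have h7 : v * 1 ≤ v * (μ.real {ω | v / 2 ≤ Z ω} * (4 * C)) := by linarith
  exact le_of_mul_le_mul_left h7 hv

/-- Second and fourth moments of a sum of independent bounded variables whose first and third
moments vanish. -/
lemma moments_sum_of_iIndepFun {Ω ι : Type*} [MeasurableSpace Ω] {μ : Measure Ω}
    [IsProbabilityMeasure μ] {f : ι → Ω → ℝ} (hf : ∀ j, Measurable (f j))
    (hbdd : ∀ j, ∃ B, ∀ ω, |f j ω| ≤ B) (hind : iIndepFun f μ)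
    (h1 : ∀ j, ∫ ω, f j ω ∂μ = 0) (h3 : ∀ j, ∫ ω, f j ω ^ 3 ∂μ = 0) {C : ℝ} (hC : 3 ≤ C)
    (h4 : ∀ j, ∫ ω, f j ω ^ 4 ∂μ ≤ C * (∫ ω, f j ω ^ 2 ∂μ) ^ 2) (I : Finset ι) :
    ∫ ω, (∑ j ∈ I, f j ω) ∂μ = 0 ∧
    ∫ ω, (∑ j ∈ I, f j ω) ^ 2 ∂μ = ∑ j ∈ I, ∫ ω, f j ω ^ 2 ∂μ ∧
    ∫ ω, (∑ j ∈ I, f j ω) ^ 4 ∂μ ≤ C * (∑ j ∈ I, ∫ ω, f j ω ^ 2 ∂μ) ^ 2 := by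
  classical
  induction I using Finset.induction_on with
  | empty => simp
  | insert i I hi ih =>
    obtain ⟨ih1, ih2, ih4⟩ := ih
    set S : Ω → ℝ := fun ω => ∑ j ∈ I, f j ω with hS
    have hSm : Measurable S := Finset.measurable_sum _ fun j _ => hf j
    have hSb : ∃ B, ∀ ω, |S ω| ≤ B := by
      choose B hB using hbdd
      exact ⟨∑ j ∈ I, B j, fun ω =>
        (Finset.abs_sum_le_sum_abs _ _).trans (Finset.sum_le_sum fun j _ => hB j ω)⟩
    have hSf : IndepFun S (f i) μ := by
      have := hind.indepFun_finsetSum_of_notMem hf hi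
      convert this using 1
      ext ω
      simp [hS]
    have hprod : ∀ a b : ℕ, Integrable (fun ω => S ω ^ a * f i ω ^ b) μ := by
      intro a b
      obtain ⟨B, hB⟩ := hSb
      obtain ⟨B', hB'⟩ := hbdd i
      refine Integrable.of_bound ((hSm.pow_const a).mul ((hf i).pow_const b)).aestronglyMeasurable
        (B ^ a * B' ^ b) (Filter.Eventually.of_forall fun ω => ?_)
      rw [Real.norm_eq_abs, abs_mul, abs_pow, abs_pow]
      gcongr
      · exact pow_nonneg ((abs_nonneg _).trans (hB ω)) _
      · exact hB ω
      · exact hB' ω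
    have hmul : ∀ a b : ℕ, ∫ ω, S ω ^ a * f i ω ^ b ∂μ =
        (∫ ω, S ω ^ a ∂μ) * ∫ ω, f i ω ^ b ∂μ := by
      intro a b
      exact (hSf.comp (φ := fun t => t ^ a) (ψ := fun t => t ^ b) (measurable_id.pow_const a)
        (measurable_id.pow_const b)).integral_fun_mul_eq_mul_integral
        (hSm.pow_const a).aestronglyMeasurable ((hf i).pow_const b).aestronglyMeasurable
    have hSi : ∀ a : ℕ, Integrable (fun ω => S ω ^ a) μ := fun a => by simpa using hprod a 0
    have hfi : ∀ a : ℕ, Integrable (fun ω => f i ω ^ a) μ := fun a => by simpa using hprod 0 a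
    have hSi1 : Integrable S μ := by simpa using hSi 1
    have hfi1 : Integrable (f i) μ := by simpa using hfi 1
    simp_rw [Finset.sum_insert hi]
    change ∫ ω, (f i ω + S ω) ∂μ = 0 ∧ ∫ ω, (f i ω + S ω) ^ 2 ∂μ = _ ∧
      ∫ ω, (f i ω + S ω) ^ 4 ∂μ ≤ _
    have e11 := hmul 1 1
    have e31 := hmul 3 1
    have e13 := hmul 1 3
    have e22 := hmul 2 2
    have ih1' : ∫ ω, S ω ∂μ = 0 := ih1
    have ih2' : ∫ ω, S ω ^ 2 ∂μ = ∑ j ∈ I, ∫ ω, f j ω ^ 2 ∂μ := ih2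
    have ih4' : ∫ ω, S ω ^ 4 ∂μ ≤ C * (∑ j ∈ I, ∫ ω, f j ω ^ 2 ∂μ) ^ 2 := ih4
    simp only [pow_one, h1 i, h3 i, mul_zero, ih1'] at e11 e31 e13
    refine ⟨?_, ?_, ?_⟩
    · rw [integral_add hfi1 hSi1, h1 i, ih1', add_zero]
    · have : ∀ ω, (f i ω + S ω) ^ 2 = f i ω ^ 2 + 2 * (S ω ^ 1 * f i ω ^ 1) + S ω ^ 2 :=
        fun ω => by ring
      simp_rw [this]
      have i1 : Integrable (fun ω => f i ω ^ 2 + 2 * (S ω ^ 1 * f i ω ^ 1)) μ :=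
        (hfi 2).add ((hprod 1 1).const_mul 2)
      rw [integral_add i1 (hSi 2),
        integral_add (hfi 2) ((hprod 1 1).const_mul 2), integral_const_mul]
      simp only [pow_one, e11, ih2']
      ring
    · have : ∀ ω, (f i ω + S ω) ^ 4 = f i ω ^ 4 + 4 * (S ω ^ 1 * f i ω ^ 3) +
          6 * (S ω ^ 2 * f i ω ^ 2) + 4 * (S ω ^ 3 * f i ω ^ 1) + S ω ^ 4 :=
        fun ω => by ring
      simp_rw [this]
      have i1 : Integrable (fun ω => f i ω ^ 4 + 4 * (S ω ^ 1 * f i ω ^ 3)) μ :=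
        (hfi 4).add ((hprod 1 3).const_mul 4)
      have i2 : Integrable (fun ω => f i ω ^ 4 + 4 * (S ω ^ 1 * f i ω ^ 3) +
          6 * (S ω ^ 2 * f i ω ^ 2)) μ := i1.add ((hprod 2 2).const_mul 6)
      have i3 : Integrable (fun ω => f i ω ^ 4 + 4 * (S ω ^ 1 * f i ω ^ 3) +
          6 * (S ω ^ 2 * f i ω ^ 2) + 4 * (S ω ^ 3 * f i ω ^ 1)) μ :=
        i2.add ((hprod 3 1).const_mul 4)
      rw [integral_add i3 (hSi 4), integral_add i2 ((hprod 3 1).const_mul 4),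
        integral_add i1 ((hprod 2 2).const_mul 6), integral_add (hfi 4) ((hprod 1 3).const_mul 4),
        integral_const_mul, integral_const_mul, integral_const_mul, e22, ih2']
      simp only [pow_one, e13, e31]
      have hi4 := h4 i
      have hn1 : 0 ≤ ∫ ω, f i ω ^ 2 ∂μ := integral_nonneg fun ω => sq_nonneg _
      have hn2 : 0 ≤ ∑ j ∈ I, ∫ ω, f j ω ^ 2 ∂μ :=
        Finset.sum_nonneg fun j _ => integral_nonneg fun ω => sq_nonneg _
      nlinarith [mul_nonneg (sub_nonneg.2 hC) (mul_nonneg hn1 hn2)]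

lemma measurable_sum_mul {ι : Type*} (z : ι → ℝ) (I : Finset ι) :
    Measurable fun x : ι → ℝ => ∑ j ∈ I, z j * x j :=
  Finset.measurable_sum _ fun j _ => (measurable_pi_apply j).const_mul _

lemma integral_eq_zero_of_odd {ν : Measure ℝ} (hν : MeasurePreserving Neg.neg ν ν) {g : ℝ → ℝ}
    (hg : ∀ t, g (-t) = -g t) : ∫ t, g t ∂ν = 0 := by
  have h : ∫ t, g (-t) ∂ν = ∫ t, g t ∂ν :=
    hν.integral_comp (MeasurableEquiv.neg ℝ).measurableEmbedding g
  simp_rw [hg, integral_neg] at h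
  linarith

section ProductLaw

variable {ι : Type*} [Fintype ι] {ν : Measure ℝ} [IsProbabilityMeasure ν]

lemma measurePreserving_neg_pi (hν : MeasurePreserving Neg.neg ν ν) :
    MeasurePreserving (fun (x : ι → ℝ) i => -x i) (Measure.pi fun _ => ν)
      (Measure.pi fun _ => ν) :=
  measurePreserving_pi _ _ fun _ => hν

lemma measureReal_abs_le_two_mul (hν : MeasurePreserving Neg.neg ν ν) (z : ι → ℝ) (I : Finset ι)
    (s : ℝ) :
    (Measure.pi fun _ : ι => ν).real {x | s ≤ |∑ j ∈ I, z j * x j|} ≤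
      2 * (Measure.pi fun _ : ι => ν).real {x | s ≤ ∑ j ∈ I, z j * x j} := by
  have hm : MeasurableSet {x : ι → ℝ | s ≤ ∑ j ∈ I, z j * x j} :=
    measurableSet_le measurable_const (measurable_sum_mul z I)
  have hsub : {x : ι → ℝ | s ≤ |∑ j ∈ I, z j * x j|} ⊆ {x | s ≤ ∑ j ∈ I, z j * x j} ∪
      (fun (x : ι → ℝ) i => -x i) ⁻¹' {x | s ≤ ∑ j ∈ I, z j * x j} := by
    intro x hx
    simpa [le_abs] using hx
  refine (measureReal_mono hsub).trans ((measureReal_union_le _ _).trans ?_)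
  rw [(measurePreserving_neg_pi hν).measureReal_preimage hm.nullMeasurableSet, two_mul]

/-- Truncating the coordinates of a symmetric vector to a symmetric set costs at most a factor
of two: the sum with the signs of the discarded coordinates reversed has the same law. -/
lemma measureReal_truncated_le_two_mul (hν : MeasurePreserving Neg.neg ν ν) {T : Set ℝ}
    (hT : MeasurableSet T) (hTs : ∀ t, -t ∈ T ↔ t ∈ T) (z : ι → ℝ) (I : Finset ι) (s : ℝ) :
    (Measure.pi fun _ : ι => ν).real {x | s ≤ |∑ j ∈ I, z j * T.indicator id (x j)|} ≤
      2 * (Measure.pi fun _ : ι => ν).real {x | s ≤ |∑ j ∈ I, z j * x j|} := by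
  classical
  have hm : MeasurableSet {x : ι → ℝ | s ≤ |∑ j ∈ I, z j * x j|} :=
    measurableSet_le measurable_const (measurable_sum_mul z I).abs
  set g : ℝ → ℝ := fun t => if t ∈ T then t else -t with hg
  have hgm : Measurable g := Measurable.ite hT measurable_id measurable_neg
  have hgp : MeasurePreserving g ν ν := by
    refine ⟨hgm, ?_⟩
    ext s hs
    rw [Measure.map_apply hgm hs]
    have h1 : g ⁻¹' s = (s ∩ T) ∪ ((Neg.neg ⁻¹' s) ∩ Tᶜ) := by
      ext t
      by_cases ht : t ∈ T <;> simp [hg, ht]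
    have h2 : ν ((Neg.neg ⁻¹' s) ∩ Tᶜ) = ν (s ∩ Tᶜ) := by
      rw [← hν.measure_preimage (hs.inter hT.compl).nullMeasurableSet]
      congr 1
      ext t
      simp [hTs]
    rw [h1, measure_union _ ((measurable_neg hs).inter hT.compl), h2,
      ← Set.sdiff_eq, measure_inter_add_sdiff s hT]
    exact Set.disjoint_left.2 fun t h h' => h'.2 h.2
  have hgpi : MeasurePreserving (fun (x : ι → ℝ) i => g (x i)) (Measure.pi fun _ => ν)
      (Measure.pi fun _ => ν) := measurePreserving_pi _ _ fun _ => hgp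
  have hsub : {x : ι → ℝ | s ≤ |∑ j ∈ I, z j * T.indicator id (x j)|} ⊆
      {x | s ≤ |∑ j ∈ I, z j * x j|} ∪
      (fun (x : ι → ℝ) i => g (x i)) ⁻¹' {x | s ≤ |∑ j ∈ I, z j * x j|} := by
    intro x hx
    have hsum : ∑ j ∈ I, z j * x j + ∑ j ∈ I, z j * g (x j) =
        2 * ∑ j ∈ I, z j * T.indicator id (x j) := by
      rw [← Finset.sum_add_distrib, Finset.mul_sum]
      refine Finset.sum_congr rfl fun j _ => ?_
      by_cases ht : x j ∈ T <;> simp [hg, ht]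
      ring
    have hx' : s ≤ |∑ j ∈ I, z j * T.indicator id (x j)| := hx
    by_contra hcon
    simp only [Set.mem_union, Set.mem_preimage, not_or] at hcon
    have h1 : |∑ j ∈ I, z j * x j| < s := not_le.1 hcon.1
    have h2 : |∑ j ∈ I, z j * g (x j)| < s := not_le.1 hcon.2
    rw [abs_lt] at h1 h2
    have h3 : |∑ j ∈ I, z j * T.indicator id (x j)| < s := by
      rw [abs_lt]
      constructor <;> linarith
    linarith
  refine (measureReal_mono hsub).trans ((measureReal_union_le _ _).trans ?_)
  rw [hgpi.measureReal_preimage hm.nullMeasurableSet, two_mul]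

/-- Every linear form exceeds a multiple of the norm of its coefficients with probability bounded
below: the truncated form satisfies the Paley-Zygmund inequality, and passing from it to one side
of the original form costs a factor of four. -/
lemma small_ball_block (hν : MeasurePreserving Neg.neg ν ν) {τ q M C : ℝ} (hτ : 0 < τ)
    (hq : 0 < q) (hC : 3 ≤ C) (hCM : M ^ 2 ≤ C * (τ ^ 2 * q))
    (h : q ≤ ν.real {t | τ ≤ |t| ∧ |t| ≤ M}) (z : ι → ℝ) (I : Finset ι) :
    1 / (16 * C) ≤ (Measure.pi fun _ : ι => ν).real
      {x | τ * √(q / 2) * √(∑ j ∈ I, z j ^ 2) ≤ ∑ j ∈ I, z j * x j} := by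
  set T : Set ℝ := {t | τ ≤ |t| ∧ |t| ≤ M} with hTdef
  have hT : MeasurableSet T :=
    (measurableSet_le measurable_const measurable_id.abs).inter
      (measurableSet_le measurable_id.abs measurable_const)
  have hTs : ∀ t, -t ∈ T ↔ t ∈ T := fun t => by simp [hTdef]
  have hC0 : 0 < C := by linarith
  have hodd : ∀ t, T.indicator id (-t) = -T.indicator (id : ℝ → ℝ) t := fun t => by
    by_cases ht : t ∈ T
    · rw [Set.indicator_of_mem ((hTs t).2 ht), Set.indicator_of_mem ht]
      rfl
    · rw [Set.indicator_of_notMem (mt (hTs t).1 ht), Set.indicator_of_notMem ht, neg_zero]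
  set g : ℝ → ℝ := T.indicator id with hg
  have hgm : Measurable g := measurable_id.indicator hT
  have hgb : ∀ t, |g t| ≤ |M| := fun t => by
    by_cases ht : t ∈ T
    · rw [hg, Set.indicator_of_mem ht]
      exact ht.2.trans (le_abs_self M)
    · rw [hg, Set.indicator_of_notMem ht]
      simp
  have hgi : ∀ a : ℕ, Integrable (fun t => g t ^ a) ν := fun a =>
    Integrable.of_bound (hgm.pow_const a).aestronglyMeasurable (|M| ^ a)
      (Filter.Eventually.of_forall fun t => by
        rw [Real.norm_eq_abs, abs_pow]
        exact pow_le_pow_left₀ (abs_nonneg _) (hgb t) a)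
  set w : ℝ := ∫ t, g t ^ 2 ∂ν with hw
  have hwq : τ ^ 2 * q ≤ w := by
    have h1 : ∫ t, T.indicator (fun _ => τ ^ 2) t ∂ν ≤ w := by
      refine integral_mono ((integrable_const _).indicator hT) (hgi 2) fun t => ?_
      by_cases ht : t ∈ T
      · simp only [hg, Set.indicator_of_mem ht, id]
        rw [← sq_abs t]
        exact pow_le_pow_left₀ hτ.le ht.1 2
      · simp only [hg, Set.indicator_of_notMem ht]
        positivity
    rw [integral_indicator hT, integral_const, smul_eq_mul, measureReal_restrict_apply_univ] at h1
    have := mul_le_mul_of_nonneg_left h (sq_nonneg τ)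
    linarith
  have hw0 : 0 < w := lt_of_lt_of_le (by positivity) hwq
  have hg4 : ∫ t, g t ^ 4 ∂ν ≤ C * w ^ 2 := by
    have h1 : ∫ t, g t ^ 4 ∂ν ≤ ∫ t, M ^ 2 * g t ^ 2 ∂ν := by
      refine integral_mono (hgi 4) ((hgi 2).const_mul _) fun t => ?_
      have : g t ^ 2 ≤ M ^ 2 := sq_le_sq.2 (hgb t)
      nlinarith [sq_nonneg (g t)]
    rw [integral_const_mul] at h1
    have h2 : M ^ 2 * w ≤ C * w * w := by
      refine mul_le_mul_of_nonneg_right (hCM.trans ?_) hw0.le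
      exact mul_le_mul_of_nonneg_left hwq hC0.le
    calc _ ≤ M ^ 2 * w := h1
      _ ≤ C * w ^ 2 := by rw [sq w]; linarith
  set π : Measure (ι → ℝ) := Measure.pi fun _ : ι => ν with hπ
  have hint : ∀ (j : ι) (φ : ℝ → ℝ), AEStronglyMeasurable φ ν →
      ∫ x, φ (x j) ∂π = ∫ t, φ t ∂ν := fun j φ hφ => by
    have hp := measurePreserving_eval (fun _ : ι => ν) j
    rw [← hp.map_eq, integral_map hp.measurable.aemeasurable (by rwa [hp.map_eq])]
  set f : ι → (ι → ℝ) → ℝ := fun j x => z j * g (x j) with hf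
  have hfm : ∀ j, Measurable (f j) := fun j =>
    (hgm.comp (measurable_pi_apply j)).const_mul _
  have hmom : ∀ (j : ι) (a : ℕ), ∫ x, f j x ^ a ∂π = z j ^ a * ∫ t, g t ^ a ∂ν := fun j a => by
    simp only [hf, mul_pow]
    rw [integral_const_mul, hint j (fun t => g t ^ a) (hgm.pow_const a).aestronglyMeasurable]
  obtain ⟨-, m2, m4⟩ := moments_sum_of_iIndepFun (μ := π) hfm
    (fun j => ⟨|z j| * |M|, fun x => by
      rw [hf, abs_mul]
      exact mul_le_mul_of_nonneg_left (hgb _) (abs_nonneg _)⟩)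
    (iIndepFun_pi (X := fun j t => z j * g t) fun j => (hgm.const_mul _).aemeasurable)
    (fun j => by
      have := hmom j 1
      simp only [pow_one] at this
      rw [this, integral_eq_zero_of_odd hν hodd, mul_zero])
    (fun j => by
      rw [hmom j 3, integral_eq_zero_of_odd hν (fun t => by rw [hodd]; ring), mul_zero])
    hC
    (fun j => by
      rw [hmom j 4, hmom j 2]
      have := mul_le_mul_of_nonneg_left hg4 (by positivity : 0 ≤ z j ^ 4)
      linarith) I
  simp only [hmom _ 2] at m2 m4
  rw [← Finset.sum_mul] at m2 m4
  set V : ℝ := ∑ j ∈ I, z j ^ 2 with hV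
  have hV0 : 0 ≤ V := Finset.sum_nonneg fun j _ => sq_nonneg _
  have htwo : (4 : ℝ)⁻¹ * (1 / (4 * C)) = 1 / (16 * C) := by field_simp; norm_num
  rcases hV0.eq_or_lt with hV1 | hV1
  · -- All coefficients vanish, so the event is the whole space.
    have hz : ∀ j ∈ I, z j = 0 := fun j hj => by
      have := (Finset.sum_eq_zero_iff_of_nonneg fun j _ => sq_nonneg (z j)).1 hV1.symm j hj
      simpa using this
    have huniv : {x : ι → ℝ | τ * √(q / 2) * √V ≤ ∑ j ∈ I, z j * x j} = Set.univ := by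
      ext x
      have h0 : ∑ j ∈ I, z j * x j = 0 :=
        Finset.sum_eq_zero fun j hj => by rw [hz j hj, zero_mul]
      simp [← hV1, h0]
    rw [huniv, probReal_univ, div_le_one (by positivity)]
    linarith
  · have hSm : Measurable fun x : ι → ℝ => ∑ j ∈ I, f j x :=
      Finset.measurable_sum _ fun j _ => hfm j
    have hSb : ∀ x, |∑ j ∈ I, f j x| ≤ ∑ j ∈ I, |z j| * |M| := fun x =>
      (Finset.abs_sum_le_sum_abs _ _).trans (Finset.sum_le_sum fun j _ => by
        rw [hf, abs_mul]
        exact mul_le_mul_of_nonneg_left (hgb _) (abs_nonneg _))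
    have hSi : ∀ a : ℕ, Integrable (fun x => (∑ j ∈ I, f j x) ^ a) π := fun a =>
      Integrable.of_bound (hSm.pow_const a).aestronglyMeasurable ((∑ j ∈ I, |z j| * |M|) ^ a)
        (Filter.Eventually.of_forall fun x => by
          rw [Real.norm_eq_abs, abs_pow]
          exact pow_le_pow_left₀ (abs_nonneg _) (hSb x) a)
    have hpz := paley_zygmund_half (μ := π) (Z := fun x => (∑ j ∈ I, f j x) ^ 2)
      (v := V * w) (C := C) (hSi 2) (by simpa only [← pow_mul] using hSi 4)
      (by positivity) hC0 m2 (by simpa only [← pow_mul] using m4)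
    have hsub : {x : ι → ℝ | V * w / 2 ≤ (∑ j ∈ I, f j x) ^ 2} ⊆
        {x | τ * √(q / 2) * √V ≤ |∑ j ∈ I, z j * g (x j)|} := by
      intro x hx
      have hx' : V * w / 2 ≤ (∑ j ∈ I, f j x) ^ 2 := hx
      refine (abs_le_of_sq_le_sq' ?_ (abs_nonneg (∑ j ∈ I, z j * g (x j)))).2
      rw [sq_abs, mul_pow, mul_pow, Real.sq_sqrt (by positivity), Real.sq_sqrt hV0]
      refine le_trans ?_ hx'
      have := mul_le_mul_of_nonneg_left hwq hV0
      linarith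
    have h1 := hpz.trans (measureReal_mono hsub)
    have h2 := measureReal_truncated_le_two_mul hν hT hTs z I (τ * √(q / 2) * √V)
    have h3 := measureReal_abs_le_two_mul hν z I (τ * √(q / 2) * √V)
    rw [← htwo]
    linarith

lemma measureReal_mul_le_of_disjoint (z : ι → ℝ) {J J' : Finset ι}
    (hJ : Disjoint J J') (s t : ℝ) :
    (Measure.pi fun _ : ι => ν).real {x | s ≤ ∑ j ∈ J, z j * x j} *
      (Measure.pi fun _ : ι => ν).real {x | t ≤ ∑ j ∈ J', z j * x j} ≤
      (Measure.pi fun _ : ι => ν).real {x | s + t ≤ ∑ j ∈ J.disjUnion J' hJ, z j * x j} := by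
  have hind : iIndepFun (fun (j : ι) (x : ι → ℝ) => x j) (Measure.pi fun _ => ν) :=
    iIndepFun_pi (X := fun _ t => t) fun _ => aemeasurable_id
  have h2 := hind.indepFun_finset J J' hJ fun j => measurable_pi_apply j
  have hm : ∀ (J : Finset ι) (s : ℝ), MeasurableSet {y : J → ℝ | s ≤ ∑ j : J, z j * y j} :=
    fun J s => measurableSet_le measurable_const
      (Finset.measurable_sum _ fun j _ => (measurable_pi_apply j).const_mul _)
  have hpre : ∀ (J : Finset ι) (s : ℝ), {x : ι → ℝ | s ≤ ∑ j ∈ J, z j * x j} =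
      (fun (x : ι → ℝ) (j : J) => x j) ⁻¹' {y : J → ℝ | s ≤ ∑ j : J, z j * y j} := by
    intro J s
    ext x
    simp only [Set.mem_ofPred_eq, Set.mem_preimage]
    rw [Finset.sum_coe_sort J fun j => z j * x j]
  have h3 := h2.measure_inter_preimage_eq_mul _ _ (hm J s) (hm J' t)
  rw [measureReal_def, measureReal_def, ← ENNReal.toReal_mul, hpre J s, hpre J' t, ← h3,
    ← hpre J s, ← hpre J' t, ← measureReal_def]
  refine measureReal_mono fun x hx => ?_
  have h1 : s ≤ ∑ j ∈ J, z j * x j := hx.1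
  have h2 : t ≤ ∑ j ∈ J', z j * x j := hx.2
  change s + t ≤ _
  rw [Finset.sum_disjUnion]
  exact add_le_add h1 h2

/-- Greedy choice of a block whose mass lies between `R` and `2 R`. -/
lemma exists_subset_sum_between {ι : Type*} {a : ι → ℝ} {R : ℝ} (hR : 0 < R) {I : Finset ι}
    (haR : ∀ j ∈ I, a j ≤ R) (hI : R ≤ ∑ j ∈ I, a j) :
    ∃ J ⊆ I, R ≤ ∑ j ∈ J, a j ∧ ∑ j ∈ J, a j ≤ 2 * R := by
  classical
  induction I using Finset.induction_on with
  | empty => exact absurd hI (not_le.2 (by simpa using hR))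
  | insert i I hi ih =>
    by_cases h : R ≤ ∑ j ∈ I, a j
    · obtain ⟨J, hJ, h⟩ := ih (fun j hj => haR j (Finset.mem_insert_of_mem hj)) h
      exact ⟨J, hJ.trans (Finset.subset_insert _ _), h⟩
    · refine ⟨insert i I, subset_rfl, hI, ?_⟩
      rw [Finset.sum_insert hi]
      have := haR i (Finset.mem_insert_self _ _)
      push Not at h
      linarith

/-- A Montgomery-Smith type lower tail bound. The coordinates are split into blocks of mass about
`R` (and single coordinates of larger mass); on every block the linear form is large with
probability at least `β`, and the blocks are independent. -/
lemma exp_le_measureReal_linear_form [DecidableEq ι] {α α' β R : ℝ} {x z : ι → ℝ} (hα' : 0 ≤ α')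
    (hR : 0 < R) (hβR : Real.exp (-(R / 2)) ≤ β) (hαα' : α' * √(2 * R) ≤ α)
    (hblock : ∀ I : Finset ι, β ≤ (Measure.pi fun _ : ι => ν).real
      {y | α * √(∑ j ∈ I, z j ^ 2) ≤ ∑ j ∈ I, z j * y j})
    (hsingle : ∀ i, R < x i ^ 2 → Real.exp (-(x i ^ 2 / 2)) ≤
      (Measure.pi fun _ : ι => ν).real {y | α' * (x i * z i) ≤ z i * y i}) (I : Finset ι) :
    β * Real.exp (-((∑ j ∈ I, x j ^ 2) / 2)) ≤ (Measure.pi fun _ : ι => ν).real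
      {y | α' * ∑ j ∈ I, x j * z j ≤ ∑ j ∈ I, z j * y j} := by
  have hβ0 : 0 ≤ β := (Real.exp_pos _).le.trans hβR
  have hcs : ∀ J : Finset ι, ∑ j ∈ J, x j ^ 2 ≤ 2 * R →
      {y : ι → ℝ | α * √(∑ j ∈ J, z j ^ 2) ≤ ∑ j ∈ J, z j * y j} ⊆
        {y | α' * ∑ j ∈ J, x j * z j ≤ ∑ j ∈ J, z j * y j} := by
    intro J hJ y hy
    have hy' : α * √(∑ j ∈ J, z j ^ 2) ≤ ∑ j ∈ J, z j * y j := hy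
    refine le_trans ?_ hy'
    have h1 : ∑ j ∈ J, x j * z j ≤ √(∑ j ∈ J, x j ^ 2) * √(∑ j ∈ J, z j ^ 2) :=
      Real.sum_mul_le_sqrt_mul_sqrt J x z
    have h2 : √(∑ j ∈ J, x j ^ 2) ≤ √(2 * R) := Real.sqrt_le_sqrt hJ
    calc α' * ∑ j ∈ J, x j * z j ≤ α' * (√(2 * R) * √(∑ j ∈ J, z j ^ 2)) := by
          refine mul_le_mul_of_nonneg_left (h1.trans ?_) hα'
          exact mul_le_mul_of_nonneg_right h2 (Real.sqrt_nonneg _)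
      _ ≤ α * √(∑ j ∈ J, z j ^ 2) := by
          rw [← mul_assoc]
          exact mul_le_mul_of_nonneg_right hαα' (Real.sqrt_nonneg _)
  induction I using Finset.strongInduction with
  | H I ih =>
    -- Splitting off a block `J` of positive mass reduces the claim for `I` to that for `I \ J`.
    have hpeel : ∀ J ⊆ I, J.Nonempty → Real.exp (-((∑ j ∈ J, x j ^ 2) / 2)) ≤
        (Measure.pi fun _ : ι => ν).real {y | α' * ∑ j ∈ J, x j * z j ≤ ∑ j ∈ J, z j * y j} →
        β * Real.exp (-((∑ j ∈ I, x j ^ 2) / 2)) ≤ (Measure.pi fun _ : ι => ν).real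
          {y | α' * ∑ j ∈ I, x j * z j ≤ ∑ j ∈ I, z j * y j} := by
      intro J hJI hJn hJ
      have h1 := ih (I \ J) (Finset.sdiff_ssubset hJI hJn)
      have h2 := measureReal_mul_le_of_disjoint (ν := ν) z (Finset.disjoint_sdiff (s := J) (t := I))
        (α' * ∑ j ∈ J, x j * z j) (α' * ∑ j ∈ I \ J, x j * z j)
      have hIJ : J.disjUnion (I \ J) Finset.disjoint_sdiff = I := by
        rw [Finset.disjUnion_eq_union, Finset.union_sdiff_of_subset hJI]
      rw [hIJ, ← mul_add, add_comm (∑ j ∈ J, x j * z j), Finset.sum_sdiff hJI] at h2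
      refine le_trans ?_ h2
      refine le_trans (le_of_eq ?_)
        (mul_le_mul hJ h1 (by positivity) measureReal_nonneg)
      rw [← Finset.sum_sdiff hJI, mul_left_comm, ← Real.exp_add]
      congr 2
      ring
    by_cases hbig : ∃ i ∈ I, R < x i ^ 2
    · obtain ⟨i, hi, hxi⟩ := hbig
      refine hpeel {i} (by simpa using hi) (by simp) ?_
      simpa using hsingle i hxi
    · push Not at hbig
      by_cases hmass : ∑ j ∈ I, x j ^ 2 ≤ 2 * R
      · refine le_trans ?_ ((hblock I).trans (measureReal_mono (hcs I hmass)))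
        refine mul_le_of_le_one_right hβ0 (Real.exp_le_one_iff.2 ?_)
        have : 0 ≤ ∑ j ∈ I, x j ^ 2 := Finset.sum_nonneg fun j _ => sq_nonneg _
        linarith
      · push Not at hmass
        obtain ⟨J, hJI, hJ1, hJ2⟩ := exists_subset_sum_between hR hbig (by linarith)
        refine hpeel J hJI ?_ ?_
        · by_contra hne
          rw [Finset.not_nonempty_iff_eq_empty] at hne
          rw [hne, Finset.sum_empty] at hJ1
          linarith
        · refine le_trans ?_ ((hblock J).trans (measureReal_mono (hcs J hJ2)))
          refine le_trans (Real.exp_le_exp.2 ?_) hβR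
          linarith

end ProductLaw

/-! ### The union bound over vertices -/

section UnionBound

/-- If `zf` only depends on the coordinates in `T`, then conditionally on those coordinates the
remaining ones are independent of `zf`. -/
lemma measure_pi_le_pow_card_compl {ι E F : Type*} [Fintype ι] [DecidableEq ι] [MeasurableSpace E]
    [Zero E] [MeasurableSpace F] (π : Measure E) [IsProbabilityMeasure π] (T : Finset ι)
    {zf : (ι → E) → F} (hzf : Measurable zf)
    (hdep : ∀ A A' : ι → E, (∀ i ∈ T, A i = A' i) → zf A = zf A')
    {G : Set F} (hG : MeasurableSet G) {Q : Set (E × F)} (hQ : MeasurableSet Q) {r : ℝ≥0∞}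
    (hr : ∀ z ∈ G, π {y | (y, z) ∈ Q} ≤ r) :
    (Measure.pi fun _ : ι => π) {A | zf A ∈ G ∧ ∀ i ∉ T, (A i, zf A) ∈ Q} ≤ r ^ (Tᶜ).card := by
  set ext : ({i // i ∈ T} → E) → ι → E := fun u i => if h : i ∈ T then u ⟨i, h⟩ else 0 with hext
  have hextm : Measurable ext := by
    refine measurable_pi_lambda _ fun i => ?_
    by_cases h : i ∈ T
    · simpa [hext, h] using measurable_pi_apply (⟨i, h⟩ : {i // i ∈ T})
    · simp [hext, h]
  have hhm : Measurable fun u => zf (ext u) := hzf.comp hextm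
  have hz : ∀ A : ι → E, zf (ext fun i => A i) = zf A := fun A =>
    hdep _ _ fun i hi => by simp [hext, hi]
  set B : Set (({i // i ∈ T} → E) × ({i // i ∉ T} → E)) :=
    {uw | zf (ext uw.1) ∈ G ∧ ∀ i, (uw.2 i, zf (ext uw.1)) ∈ Q} with hB
  have hBm : MeasurableSet B := by
    have : B = (fun uw => zf (ext uw.1)) ⁻¹' G ∩
        ⋂ i, (fun uw => (uw.2 i, zf (ext uw.1))) ⁻¹' Q := by
      ext uw
      simp [hB]
    rw [this]
    refine ((hhm.comp measurable_fst) hG).inter (MeasurableSet.iInter fun i => ?_)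
    exact (((measurable_pi_apply i).comp measurable_snd).prodMk (hhm.comp measurable_fst)) hQ
  have hmp := measurePreserving_piEquivPiSubtypeProd (fun _ : ι => π) (fun i => i ∈ T)
  have hset : {A : ι → E | zf A ∈ G ∧ ∀ i ∉ T, (A i, zf A) ∈ Q} =
      MeasurableEquiv.piEquivPiSubtypeProd (fun _ => E) (fun i => i ∈ T) ⁻¹' B := by
    ext A
    have : zf (ext (MeasurableEquiv.piEquivPiSubtypeProd (fun _ => E) (fun i => i ∈ T) A).1) =
      zf A := hz A
    simp only [hB, Set.mem_preimage, Set.mem_ofPred_eq, this, Subtype.forall]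
    rfl
  rw [hset, hmp.measure_preimage hBm.nullMeasurableSet, Measure.prod_apply hBm]
  have hle : ∀ u, (Measure.pi fun _ : {i // i ∉ T} => π) (Prod.mk u ⁻¹' B) ≤ r ^ (Tᶜ).card := by
    intro u
    by_cases hu : zf (ext u) ∈ G
    · have : Prod.mk u ⁻¹' B = Set.univ.pi fun _ => {y | (y, zf (ext u)) ∈ Q} := by
        ext w
        simp [hB, hu, Set.mem_pi]
      rw [this, Measure.pi_pi, Finset.prod_const]
      refine (pow_le_pow_left₀ (zero_le) (hr _ hu) _).trans (le_of_eq ?_)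
      congr 1
      rw [Finset.card_univ, Fintype.card_subtype]
      congr 1
      ext i
      simp
    · have : Prod.mk u ⁻¹' B = ∅ := by
        ext w
        simp [hB, hu]
      rw [this, measure_empty]
      exact zero_le
  refine (lintegral_mono hle).trans ?_
  rw [lintegral_const, measure_univ, mul_one]

variable {m N : ℕ}

/-- The solution `z` of the linear system `⟨v (e a), z⟩ = s a`, where `v` is the family of
augmented columns. It is a measurable function of `A` and, where the selected vectors are
independent, the only solution; elsewhere it is the junk value zero. -/
noncomputable def signedVertex (δ : ℝ) (e : Fin m → Fin N ⊕ Fin m) (s : Fin m → ℤˣ)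
    (A : Fin N → Fin m → ℝ) : Fin m → ℝ :=
  (Matrix.of fun a => augmentedColumns δ A (e a))⁻¹ *ᵥ fun a => ((s a : ℤ) : ℝ)

lemma measurable_signedVertex (δ : ℝ) (e : Fin m → Fin N ⊕ Fin m) (s : Fin m → ℤˣ) :
    Measurable (signedVertex δ e s) := by
  have hc : Continuous fun A : Fin N → Fin m → ℝ =>
      (Matrix.of fun a => augmentedColumns δ A (e a) : Matrix (Fin m) (Fin m) ℝ) := by
    refine continuous_matrix fun a b => ?_
    simp only [Matrix.of_apply, augmentedColumns]
    rcases e a with i | j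
    · exact (continuous_apply b).comp (continuous_apply i)
    · exact continuous_const
  have : signedVertex δ e s = fun A => (Matrix.of fun a => augmentedColumns δ A (e a)).det⁻¹ •
      ((Matrix.of fun a => augmentedColumns δ A (e a)).adjugate *ᵥ
        fun a => ((s a : ℤ) : ℝ)) := by
    ext A b
    rw [signedVertex, Matrix.inv_def, Ring.inverse_eq_inv', Matrix.smul_mulVec]
  rw [this]
  exact hc.matrix_det.measurable.inv.smul
    ((hc.matrix_adjugate.matrix_mulVec continuous_const).measurable)

lemma eq_signedVertex {δ : ℝ} {e : Fin m → Fin N ⊕ Fin m} {A : Fin N → Fin m → ℝ}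
    (hli : LinearIndependent ℝ fun a => augmentedColumns δ A (e a)) {z : Fin m → ℝ}
    (hz : ∀ a, |augmentedColumns δ A (e a) ⬝ᵥ z| = 1) : ∃ s, z = signedVertex δ e s A := by
  have h1 : ∀ a, ∃ s : ℤˣ, augmentedColumns δ A (e a) ⬝ᵥ z = ((s : ℤ) : ℝ) := fun a => by
    rcases eq_or_eq_neg_of_abs_eq (hz a) with h | h
    · exact ⟨1, by simp [h]⟩
    · exact ⟨-1, by simp [h]⟩
  choose s hs using h1
  refine ⟨s, ?_⟩
  set M : Matrix (Fin m) (Fin m) ℝ := Matrix.of fun a => augmentedColumns δ A (e a) with hM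
  have hdet : IsUnit M.det := by
    rw [← Matrix.isUnit_iff_isUnit_det, ← Matrix.linearIndependent_rows_iff_isUnit]
    exact hli
  have hMz : M *ᵥ z = fun a => ((s a : ℤ) : ℝ) := by
    ext a
    exact hs a
  rw [signedVertex, ← hM, ← hMz, Matrix.mulVec_mulVec, Matrix.nonsing_inv_mul _ hdet,
    Matrix.one_mulVec]

lemma map_columns_eq_pi {Ω : Type*} [MeasurableSpace Ω] {μ : Measure Ω}
    {A : Ω → Matrix (Fin m) (Fin N) ℝ} {ν : Measure ℝ} [IsProbabilityMeasure ν]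
    (hA : ∀ j i, AEMeasurable (fun ω => A ω j i) μ) (hν : ∀ j i, μ.map (fun ω => A ω j i) = ν)
    (hind : iIndepFun (fun (e : Fin m × Fin N) ω => A ω e.1 e.2) μ) :
    μ.map (fun ω i => (A ω).col i) =
      Measure.pi fun _ : Fin N => Measure.pi fun _ : Fin m => ν := by
  have h1 : iIndepFun (fun (e : Fin N × Fin m) ω => A ω e.2 e.1) μ :=
    hind.precomp (g := Prod.swap) Prod.swap_injective
  have h2 := h1.map_fun_eq_infinitePi_map₀' fun e : Fin N × Fin m => hA e.2 e.1
  simp only [hν] at h2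
  have h3 : AEMeasurable (fun ω (e : Fin N × Fin m) => A ω e.2 e.1) μ :=
    aemeasurable_pi_lambda _ fun e => hA e.2 e.1
  have h4 := congrArg (Measure.map (MeasurableEquiv.curry (Fin N) (Fin m) ℝ)) h2
  rw [AEMeasurable.map_map_of_aemeasurable (MeasurableEquiv.measurable _).aemeasurable h3,
    Measure.infinitePi_map_curry (fun (_ : Fin N) (_ : Fin m) => ν)] at h4
  simp only [Measure.infinitePi_eq_pi] at h4
  exact h4

/-- Union bound over the choices of a vertex: there are `(N + m).choose m` sets of active
constraints and `2 ^ m` sign patterns, and each of the at least `N - m` columns that are not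
active misses the half-space of the vertex with probability at most `1 - p`. -/
theorem measure_not_subset_columnPolytope_le {Ω : Type*} [MeasurableSpace Ω] {μ : Measure Ω}
    {A : Ω → Matrix (Fin m) (Fin N) ℝ} {ν : Measure ℝ} [IsProbabilityMeasure ν]
    (hA : ∀ j i, AEMeasurable (fun ω => A ω j i) μ) (hν : ∀ j i, μ.map (fun ω => A ω j i) = ν)
    (hind : iIndepFun (fun (e : Fin m × Fin N) ω => A ω e.1 e.2) μ)
    {K : Set (Fin m → ℝ)} {D p : ℝ} (hD : 0 < D) (hp0 : 0 ≤ p) (hp1 : p ≤ 1)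
    (hK : ∀ (j : Fin m) (c : ℝ), |c| = 1 → Pi.single j c ∈ K)
    (hp : ∀ x ∈ K, ∀ z : Fin m → ℝ, D < x ⬝ᵥ z →
      p ≤ (Measure.pi fun _ : Fin m => ν).real {y | 1 < y ⬝ᵥ z}) :
    μ.real {ω | ¬ D⁻¹ • K ⊆ columnPolytope (A ω)} ≤
      (N + m).choose m * 2 ^ m * (1 - p) ^ (N - m) := by
  classical
  set π : Measure (Fin m → ℝ) := Measure.pi fun _ : Fin m => ν with hπ
  set G : Set (Fin m → ℝ) := {z | ∃ x ∈ K, D < x ⬝ᵥ z} with hGdef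
  have hG : MeasurableSet G := by
    have : G = ⋃ x ∈ K, {z | D < x ⬝ᵥ z} := by
      ext z
      simp [hGdef]
    rw [this]
    exact (isOpen_biUnion fun x _ => isOpen_lt continuous_const
      (continuous_const.dotProduct continuous_id)).measurableSet
  set Q : Set ((Fin m → ℝ) × (Fin m → ℝ)) := {q | |q.1 ⬝ᵥ q.2| ≤ 1} with hQdef
  have hQ : MeasurableSet Q :=
    (isClosed_le (continuous_fst.dotProduct continuous_snd).abs continuous_const).measurableSet
  have hr : ∀ z ∈ G, π {y | (y, z) ∈ Q} ≤ ENNReal.ofReal (1 - p) := by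
    rintro z ⟨x, hxK, hx⟩
    have hm : MeasurableSet {y : Fin m → ℝ | 1 < y ⬝ᵥ z} :=
      (isOpen_lt continuous_const (continuous_id.dotProduct continuous_const)).measurableSet
    have h1 : {y : Fin m → ℝ | (y, z) ∈ Q} ⊆ {y | 1 < y ⬝ᵥ z}ᶜ := by
      intro y hy
      have hy' : |y ⬝ᵥ z| ≤ 1 := hy
      simpa using (le_abs_self _).trans hy'
    have h2 := measureReal_mono (μ := π) h1
    rw [probReal_compl_eq_one_sub hm] at h2
    rw [← ofReal_measureReal]
    exact ENNReal.ofReal_le_ofReal (h2.trans (by linarith [hp x hxK z hx]))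
  let e : {S : Finset (Fin N ⊕ Fin m) // S.card = m} → Fin m → Fin N ⊕ Fin m :=
    fun S a => (S.1.equivFinOfCardEq S.2).symm a
  let T : {S : Finset (Fin N ⊕ Fin m) // S.card = m} → Finset (Fin N) :=
    fun S => Finset.univ.filter fun i => Sum.inl i ∈ S.1
  set δ : ℝ := (2 * D)⁻¹ with hδ
  set bad : {S : Finset (Fin N ⊕ Fin m) // S.card = m} × (Fin m → ℤˣ) →
      Set (Fin N → Fin m → ℝ) := fun t =>
    {B | signedVertex δ (e t.1) t.2 B ∈ G ∧
      ∀ i ∉ T t.1, (B i, signedVertex δ (e t.1) t.2 B) ∈ Q} with hbad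
  have hbadm : ∀ t, MeasurableSet (bad t) := fun t => by
    have : bad t = signedVertex δ (e t.1) t.2 ⁻¹' G ∩
        ⋂ i, ⋂ _ : i ∉ T t.1, (fun B => (B i, signedVertex δ (e t.1) t.2 B)) ⁻¹' Q := by
      ext B
      simp [hbad]
    rw [this]
    refine (measurable_signedVertex δ (e t.1) t.2 hG).inter
      (MeasurableSet.iInter fun i => MeasurableSet.iInter fun _ => ?_)
    exact ((measurable_pi_apply i).prodMk (measurable_signedVertex δ (e t.1) t.2)) hQ
  have hbadle : ∀ t, (Measure.pi fun _ : Fin N => π) (bad t) ≤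
      ENNReal.ofReal ((1 - p) ^ (N - m)) := by
    intro t
    have h1 := measure_pi_le_pow_card_compl π (T t.1) (measurable_signedVertex δ (e t.1) t.2)
      (fun B B' hBB => by
        have : ∀ a, augmentedColumns δ B (e t.1 a) = augmentedColumns δ B' (e t.1 a) := by
          intro a
          have hmem : e t.1 a ∈ t.1.1 := ((t.1.1.equivFinOfCardEq t.1.2).symm a).2
          rcases h : e t.1 a with i | j
          · exact hBB i (by simpa [T, ← h] using hmem)
          · rfl
        simp only [signedVertex, this]) hG hQ hr
    refine h1.trans ?_
    rw [ENNReal.ofReal_pow (by linarith)]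
    refine pow_le_pow_of_le_one zero_le (ENNReal.ofReal_le_one.2 (by linarith)) ?_
    have hT : (T t.1).card ≤ m := by
      calc (T t.1).card = ((T t.1).map ⟨Sum.inl, Sum.inl_injective⟩).card := by
            rw [Finset.card_map]
        _ ≤ t.1.1.card := Finset.card_le_card fun k hk => by
            obtain ⟨i, hi, rfl⟩ := Finset.mem_map.1 hk
            simpa [T] using hi
        _ = m := t.1.2
    rw [Finset.card_compl, Fintype.card_fin]
    omega
  have hcol : AEMeasurable (fun ω i => (A ω).col i) μ :=
    aemeasurable_pi_lambda _ fun i => aemeasurable_pi_lambda _ fun j => hA j i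
  have hsub : {ω | ¬ D⁻¹ • K ⊆ columnPolytope (A ω)} ⊆
      (fun ω i => (A ω).col i) ⁻¹' ⋃ t, bad t := by
    intro ω hω
    obtain ⟨S, hS, hli, z, hzG, hcols, hact⟩ :=
      exists_vertex_of_not_subset_columnPolytope (A ω) hD hK hω
    have hli' : LinearIndependent ℝ fun a => augmentedColumns δ (A ω).col (e ⟨S, hS⟩ a) :=
      hli.comp _ (S.equivFinOfCardEq hS).symm.injective
    obtain ⟨s, rfl⟩ := eq_signedVertex hli' fun a =>
      hact _ ((S.equivFinOfCardEq hS).symm a).2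
    exact Set.mem_iUnion.2 ⟨(⟨S, hS⟩, s), hzG, fun i _ => hcols i⟩
  have hfin : μ {ω | ¬ D⁻¹ • K ⊆ columnPolytope (A ω)} ≤
      ENNReal.ofReal ((N + m).choose m * 2 ^ m * (1 - p) ^ (N - m)) := by
    calc μ {ω | ¬ D⁻¹ • K ⊆ columnPolytope (A ω)}
        ≤ μ ((fun ω i => (A ω).col i) ⁻¹' ⋃ t, bad t) := measure_mono hsub
      _ = (Measure.pi fun _ : Fin N => π) (⋃ t, bad t) := by
          rw [← Measure.map_apply_of_aemeasurable hcol (MeasurableSet.iUnion hbadm),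
            map_columns_eq_pi hA hν hind]
      _ ≤ ∑ t, (Measure.pi fun _ : Fin N => π) (bad t) := measure_iUnion_fintype_le _ _
      _ ≤ ∑ _t : {S : Finset (Fin N ⊕ Fin m) // S.card = m} × (Fin m → ℤˣ),
          ENNReal.ofReal ((1 - p) ^ (N - m)) := Finset.sum_le_sum fun t _ => hbadle t
      _ = ENNReal.ofReal ((N + m).choose m * 2 ^ m * (1 - p) ^ (N - m)) := by
          rw [Finset.sum_const, Finset.card_univ, Fintype.card_prod, Fintype.card_finset_len,
            Fintype.card_sum, Fintype.card_fin, Fintype.card_fin, Fintype.card_fun,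
            Fintype.card_fin, Fintype.card_units_int, nsmul_eq_mul,
            ENNReal.ofReal_mul (by positivity)]
          congr 1
          rw [← ENNReal.ofReal_natCast]
          push_cast
          rfl
  exact ENNReal.toReal_le_of_le_ofReal
    (mul_nonneg (by positivity) (pow_nonneg (by linarith) _)) hfin

end UnionBound

/-! ### Choice of constants and the containment -/

lemma choose_mul_two_pow_mul_le {m N : ℕ} (hm : 0 < m) {β : ℝ} (hβ0 : 0 < β) (hβ1 : β ≤ 1)
    (hN : Real.exp (80 * Real.exp 1 / β) * m ≤ N) :
    1 ≤ Real.log (Real.exp 1 * N / m) ∧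
    (N + m).choose m * 2 ^ m *
      (1 - β * Real.exp (-(Real.log (Real.exp 1 * N / m) / 2))) ^ (N - m) ≤
        2 * Real.exp (-2 * m) := by
  have hm' : (0 : ℝ) < m := by exact_mod_cast hm
  have he : 1 ≤ Real.exp 1 := Real.one_le_exp zero_le_one
  have hL0 : 80 * Real.exp 1 ≤ 80 * Real.exp 1 / β := by
    rw [le_div_iff₀ hβ0]
    exact mul_le_of_le_one_right (by positivity) hβ1
  have hexp2 : 2 ≤ Real.exp (80 * Real.exp 1 / β) := by
    have := Real.add_one_le_exp (80 * Real.exp 1 / β)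
    linarith
  have hN2 : 2 * (m : ℝ) ≤ N := (mul_le_mul_of_nonneg_right hexp2 hm'.le).trans hN
  have hN0 : (0 : ℝ) < N := by linarith
  set L : ℝ := Real.log (Real.exp 1 * N / m) with hL
  have hexpL : Real.exp L = Real.exp 1 * N / m := Real.exp_log (by positivity)
  have hLβ : 80 * Real.exp 1 / β ≤ L := by
    rw [hL, Real.le_log_iff_exp_le (by positivity), le_div_iff₀ hm']
    refine hN.trans ?_
    exact le_mul_of_one_le_left hN0.le he
  have hL1 : 1 ≤ L := by linarith
  refine ⟨hL1, ?_⟩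
  set p : ℝ := β * Real.exp (-(L / 2)) with hp
  have hp0 : 0 ≤ p := by positivity
  have hp1 : p ≤ 1 := mul_le_one₀ hβ1 (Real.exp_pos _).le (Real.exp_le_one_iff.2 (by linarith))
  have hmN : m ≤ N := by
    have : (m : ℝ) ≤ N := by linarith
    exact_mod_cast this
  -- Binomial coefficients are bounded by `(2 e N / m) ^ m`.
  have hchoose : ((N + m).choose m : ℝ) ≤ Real.exp (m * (L + 1)) := by
    have h1 : ((N + m).choose m : ℝ) ≤ ((N + m : ℕ) : ℝ) ^ m / (m.factorial : ℝ) :=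
      Nat.choose_le_pow_div m (N + m)
    have h2 : (m : ℝ) ^ m / (m.factorial : ℝ) ≤ Real.exp m :=
      Real.pow_div_factorial_le_exp _ hm'.le m
    have h3 : ((N + m : ℕ) : ℝ) ≤ 2 * N / m * m := by
      rw [div_mul_cancel₀ _ hm'.ne']
      push_cast
      linarith
    calc ((N + m).choose m : ℝ) ≤ (2 * N / m * m) ^ m / (m.factorial : ℝ) :=
          h1.trans (by gcongr)
      _ = (2 * N / m) ^ m * ((m : ℝ) ^ m / (m.factorial : ℝ)) := by rw [mul_pow]; ring
      _ ≤ (2 * N / m) ^ m * Real.exp m := by gcongr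
      _ = (2 * Real.exp L) ^ m := by
          rw [← mul_one (m : ℝ), Real.exp_nat_mul, mul_one, ← mul_pow, hexpL]
          congr 1
          ring
      _ ≤ (Real.exp 1 * Real.exp L) ^ m := by
          gcongr
          linarith [Real.add_one_le_exp (1 : ℝ)]
      _ = Real.exp (m * (L + 1)) := by
          rw [← Real.exp_add, ← Real.exp_nat_mul, add_comm]
  have htwo : (2 : ℝ) ^ m ≤ Real.exp m := by
    rw [← mul_one (m : ℝ), Real.exp_nat_mul]
    exact pow_le_pow_left₀ (by norm_num) (by linarith [Real.add_one_le_exp (1 : ℝ)]) m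
  have hpow : (1 - p) ^ (N - m) ≤ Real.exp (-(p * (N / 2))) := by
    calc (1 - p) ^ (N - m) ≤ Real.exp (-p) ^ (N - m) :=
          pow_le_pow_left₀ (by linarith) (Real.one_sub_le_exp_neg p) _
      _ = Real.exp (((N - m : ℕ) : ℝ) * -p) := by rw [← Real.exp_nat_mul]
      _ ≤ _ := by
          rw [Real.exp_le_exp, Nat.cast_sub hmN]
          nlinarith
  have hpN : m * (L + 4) ≤ p * (N / 2) := by
    have h1 : p * (N / 2) = m * (β * Real.exp (L / 2) / (2 * Real.exp 1)) := by
      have h2 : (N : ℝ) = m * Real.exp L / Real.exp 1 := by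
        rw [hexpL]
        field_simp
      have h3 : Real.exp L = Real.exp (L / 2) * Real.exp (L / 2) := by
        rw [← Real.exp_add]
        congr 1
        ring
      rw [hp, h2, h3, Real.exp_neg]
      field_simp
    rw [h1]
    refine mul_le_mul_of_nonneg_left ?_ hm'.le
    have h4 := Real.quadratic_le_exp_of_nonneg (by linarith : 0 ≤ L / 2)
    rw [le_div_iff₀ (by positivity)]
    have h5 : 80 * Real.exp 1 ≤ β * L := by
      rw [div_le_iff₀ hβ0] at hLβ
      linarith
    have h6 : L ^ 2 / 8 ≤ Real.exp (L / 2) := by nlinarith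
    have h7 : β * (L ^ 2 / 8) ≤ β * Real.exp (L / 2) := mul_le_mul_of_nonneg_left h6 hβ0.le
    have h8 := mul_le_mul_of_nonneg_right h5 (by linarith : 0 ≤ L)
    have h9 : (L + 4) * (2 * Real.exp 1) ≤ 5 * L * (2 * Real.exp 1) :=
      mul_le_mul_of_nonneg_right (by linarith) (by positivity)
    linarith
  calc (N + m).choose m * 2 ^ m * (1 - p) ^ (N - m)
      ≤ Real.exp (m * (L + 1)) * Real.exp m * Real.exp (-(p * (N / 2))) := by
        gcongr
    _ = Real.exp (m * (L + 1) + m - p * (N / 2)) := by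
        rw [← Real.exp_add, ← Real.exp_add]
        congr 1
    _ ≤ Real.exp (-2 * m) := Real.exp_le_exp.2 (by linarith)
    _ ≤ 2 * Real.exp (-2 * m) := by linarith [Real.exp_pos (-2 * (m : ℝ))]

/-- A one-dimensional small-ball bound together with unit variance gives a small-ball bound for
all linear forms. -/
lemma small_ball_of_unit_variance {ι : Type*} [Fintype ι] {ν : Measure ℝ} [IsProbabilityMeasure ν]
    (hν : MeasurePreserving Neg.neg ν ν) (hint : Integrable (fun t => t ^ 2) ν)
    (hvar : ∫ t, t ^ 2 ∂ν = 1) {τ q : ℝ} (hτ : 0 < τ) (hq : 0 < q)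
    (h : 2 * q ≤ ν.real {t | τ ≤ |t|}) (z : ι → ℝ) (I : Finset ι) :
    1 / (16 * max 3 (1 / (τ ^ 2 * q ^ 2))) ≤ (Measure.pi fun _ : ι => ν).real
      {x | τ * √(q / 2) * √(∑ j ∈ I, z j ^ 2) ≤ ∑ j ∈ I, z j * x j} := by
  refine small_ball_block (M := √(1 / q)) hν hτ hq (le_max_left _ _) ?_ ?_ z I
  · rw [Real.sq_sqrt (by positivity)]
    calc 1 / q = 1 / (τ ^ 2 * q ^ 2) * (τ ^ 2 * q) := by field_simp
      _ ≤ _ := mul_le_mul_of_nonneg_right (le_max_right _ _) (by positivity)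
  · have h1 := mul_meas_ge_le_integral_of_nonneg
      (Filter.Eventually.of_forall fun t : ℝ => sq_nonneg t) hint (1 / q)
    rw [hvar, one_div, inv_mul_le_iff₀ hq, mul_one] at h1
    have h2 : {t : ℝ | τ ≤ |t|} ⊆ {t | τ ≤ |t| ∧ |t| ≤ √(1 / q)} ∪ {t | q⁻¹ ≤ t ^ 2} := by
      intro t ht
      by_cases h3 : |t| ≤ √(1 / q)
      · exact Or.inl ⟨ht, h3⟩
      · refine Or.inr ?_
        push Not at h3
        have := Real.lt_sq_of_sqrt_lt h3
        rw [sq_abs, one_div] at this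
        exact this.le
    have h3 := (measureReal_mono (μ := ν) h2).trans (measureReal_union_le _ _)
    linarith

lemma sum_sq_le_of_mem_smul_lpUnitBall {m : ℕ} {L : ℝ} (hL : 0 ≤ L) {x : Fin m → ℝ}
    (hx : x ∈ √L • lpUnitBall 2 m) : ∑ j, x j ^ 2 ≤ L := by
  obtain ⟨y, hy, rfl⟩ := hx
  have hy' : ‖WithLp.toLp 2 y‖ ≤ 1 := hy
  have h1 : ∑ j, y j ^ 2 ≤ 1 := by
    have h2 := EuclideanSpace.norm_sq_eq (WithLp.toLp 2 y : EuclideanSpace ℝ (Fin m))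
    simp only [Real.norm_eq_abs, sq_abs] at h2
    rw [← h2]
    exact pow_le_one₀ (norm_nonneg _) hy'
  simp only [Pi.smul_apply, smul_eq_mul, mul_pow, Real.sq_sqrt hL, ← Finset.mul_sum]
  exact mul_le_of_le_one_right hL h1

lemma single_mem_smul_lpUnitBall {m : ℕ} {L : ℝ} (hL : 1 ≤ L) (j : Fin m) {c : ℝ} (hc : |c| = 1) :
    Pi.single j c ∈ √L • lpUnitBall 2 m := by
  have h0 : 0 < √L := Real.sqrt_pos.2 (by linarith)
  rw [Set.mem_smul_set_iff_inv_smul_mem₀ h0.ne']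
  have h1 : ‖WithLp.toLp 2 (Pi.single j c : Fin m → ℝ)‖ = 1 := by
    rw [PiLp.toLp_single, PiLp.norm_single, Real.norm_eq_abs, hc]
  change ‖WithLp.toLp 2 ((√L)⁻¹ • (Pi.single j c : Fin m → ℝ))‖ ≤ 1
  rw [WithLp.toLp_smul, norm_smul, h1, mul_one, norm_inv, Real.norm_eq_abs, abs_of_pos h0]
  exact inv_le_one_of_one_le₀ (Real.one_le_sqrt.2 hL)

lemma mem_lpUnitBall_top_iff {m : ℕ} {x : Fin m → ℝ} :
    x ∈ lpUnitBall ∞ m ↔ ∀ j, |x j| ≤ 1 := by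
  rw [lpUnitBall, Set.mem_ofPred_eq, PiLp.norm_toLp, pi_norm_le_iff_of_nonneg zero_le_one]
  rfl

/-- The containment with high probability, from small-ball bounds for blocks of coordinates and
for single coordinates. -/
theorem le_measureReal_subset_columnPolytope {m N : ℕ} (hm : 0 < m) {Ω : Type*}
    [MeasurableSpace Ω] {μ : Measure Ω} [IsProbabilityMeasure μ]
    {A : Ω → Matrix (Fin m) (Fin N) ℝ} {ν : Measure ℝ} [IsProbabilityMeasure ν]
    (hA : ∀ j i, AEMeasurable (fun ω => A ω j i) μ) (hν : ∀ j i, μ.map (fun ω => A ω j i) = ν)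
    (hind : iIndepFun (fun (e : Fin m × Fin N) ω => A ω e.1 e.2) μ)
    {α α' β R : ℝ} (hα' : 0 < α') (hβ0 : 0 < β) (hβ1 : β ≤ 1)
    (hR : 0 < R) (hβR : Real.exp (-(R / 2)) ≤ β) (hαα' : α' * √(2 * R) ≤ α)
    (hblock : ∀ (z : Fin m → ℝ) (I : Finset (Fin m)), β ≤ (Measure.pi fun _ : Fin m => ν).real
      {y | α * √(∑ j ∈ I, z j ^ 2) ≤ ∑ j ∈ I, z j * y j})
    (hN : Real.exp (80 * Real.exp 1 / β) * m ≤ N) {K : Set (Fin m → ℝ)}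
    (hK : ∀ (j : Fin m) (c : ℝ), |c| = 1 → Pi.single j c ∈ K)
    (hK2 : ∀ x ∈ K, ∑ j, x j ^ 2 ≤ Real.log (Real.exp 1 * N / m))
    (hsingle : ∀ x ∈ K, ∀ (z : Fin m → ℝ) (i : Fin m), R < x i ^ 2 →
      Real.exp (-(x i ^ 2 / 2)) ≤
        (Measure.pi fun _ : Fin m => ν).real {y | α' * (x i * z i) ≤ z i * y i}) :
    1 - 2 * Real.exp (-2 * m) ≤ μ.real {ω | (2 / α')⁻¹ • K ⊆ columnPolytope (A ω)} := by
  obtain ⟨hL, hnum⟩ := choose_mul_two_pow_mul_le hm hβ0 hβ1 hN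
  set L : ℝ := Real.log (Real.exp 1 * N / m) with hLdef
  have hbad := measure_not_subset_columnPolytope_le (K := K) (D := 2 / α')
    (p := β * Real.exp (-(L / 2))) hA hν hind (by positivity) (by positivity)
    (mul_le_one₀ hβ1 (Real.exp_pos _).le (Real.exp_le_one_iff.2 (by linarith))) hK
    (fun x hx z hxz => by
      have h1 := exp_le_measureReal_linear_form (ν := ν) (x := x) (z := z) hα'.le hR hβR hαα'
        (hblock z) (hsingle x hx z) Finset.univ
      have h2 : Real.exp (-(L / 2)) ≤ Real.exp (-((∑ j, x j ^ 2) / 2)) :=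
        Real.exp_le_exp.2 (by linarith [hK2 x hx])
      refine (mul_le_mul_of_nonneg_left h2 hβ0.le).trans (h1.trans (measureReal_mono ?_))
      intro y hy
      have hy' : α' * ∑ j, x j * z j ≤ ∑ j, z j * y j := hy
      have hxz' : 2 < α' * ∑ j, x j * z j := by
        rw [div_lt_iff₀ hα', mul_comm] at hxz
        exact hxz
      change 1 < y ⬝ᵥ z
      rw [dotProduct_comm]
      exact (by linarith : (1 : ℝ) < 2).trans (hxz'.trans_le hy'))
  have hle := hbad.trans hnum
  have hcover : (Set.univ : Set Ω) ⊆ {ω | (2 / α')⁻¹ • K ⊆ columnPolytope (A ω)} ∪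
      {ω | ¬ (2 / α')⁻¹ • K ⊆ columnPolytope (A ω)} := fun ω _ => em _
  have h1 := (measureReal_mono (μ := μ) hcover).trans (measureReal_union_le _ _)
  rw [probReal_univ] at h1
  linarith

/-- Laws of the entries: a symmetric probability measure of variance one. -/
lemma IsIIDSymmetricMatrix.law {Ω Ω' : Type*} [MeasurableSpace Ω] [MeasurableSpace Ω'] {m N : ℕ}
    {A : Ω → Matrix (Fin m) (Fin N) ℝ} {μ : Measure Ω} {X : Ω' → ℝ} {P : Measure Ω'}
    [IsProbabilityMeasure P] (h : IsIIDSymmetricMatrix A μ X P) (hX : IsStandardized X P) :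
    IsProbabilityMeasure (P.map X) ∧ MeasurePreserving Neg.neg (P.map X) (P.map X) ∧
      Integrable (fun t => t ^ 2) (P.map X) ∧ ∫ t, t ^ 2 ∂(P.map X) = 1 := by
  have hXm : AEMeasurable X P := hX.memLp.aestronglyMeasurable.aemeasurable
  refine ⟨Measure.isProbabilityMeasure_map hXm, ⟨measurable_neg, ?_⟩, ?_, ?_⟩
  · rw [AEMeasurable.map_map_of_aemeasurable measurable_neg.aemeasurable hXm]
    exact h.symmetric_unit_variance.symmetric.map_eq.symm
  · rw [integrable_map_measure (by fun_prop) hXm]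
    exact hX.memLp.integrable_sq
  · rw [integral_map hXm (by fun_prop), ← variance_of_integral_eq_zero hXm hX.mean_zero]
    exact hX.unit_variance

/-- The standard Gaussian tail is at least of order `exp (-r ^ 2)`. -/
lemma exp_le_gaussianReal_tail {r : ℝ} (hr : 0 ≤ r) :
    Real.exp (-1) / √(2 * Real.pi) * Real.exp (-r ^ 2) ≤ (gaussianReal 0 1).real {x | r < x} := by
  have hsub : Set.Ioc r (r + 1) ⊆ {x | r < x} := fun x hx => hx.1
  refine le_trans ?_ (measureReal_mono hsub)
  rw [measureReal_def, gaussianReal_apply_eq_integral _ one_ne_zero,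
    ENNReal.toReal_ofReal (integral_nonneg fun x => gaussianPDFReal_nonneg _ _ _)]
  have hc : ∫ _x in Set.Ioc r (r + 1), Real.exp (-1) / √(2 * Real.pi) * Real.exp (-r ^ 2) =
      Real.exp (-1) / √(2 * Real.pi) * Real.exp (-r ^ 2) := by
    simp
  rw [← hc]
  refine setIntegral_mono_on (integrableOn_const (by simp)) (integrable_gaussianPDFReal 0 1).integrableOn
    measurableSet_Ioc fun x hx => ?_
  have h1 : Real.exp (-1) * Real.exp (-r ^ 2) ≤ Real.exp (-(x - 0) ^ 2 / (2 * (1 : NNReal))) := by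
    rw [← Real.exp_add, Real.exp_le_exp]
    simp only [sub_zero, NNReal.coe_one, mul_one]
    have : x ^ 2 ≤ (r + 1) ^ 2 := pow_le_pow_left₀ (hr.trans hx.1.le) hx.2 2
    nlinarith [sq_nonneg (r - 1)]
  rw [gaussianPDFReal]
  simp only [NNReal.coe_one, mul_one] at h1 ⊢
  rw [div_mul_eq_mul_div, div_eq_inv_mul]
  exact mul_le_mul_of_nonneg_left h1 (by positivity)

/-! ### The two classes of entries -/

lemma measurableSet_le_abs (t : ℝ) : MeasurableSet {y : ℝ | t ≤ |y|} :=
  measurableSet_le measurable_const measurable_id.abs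

/-- A fourth moment bound keeps a standardized variable away from zero with positive
probability. -/
lemma small_ball_of_eLpNorm_four_le {Ω' : Type*} [MeasurableSpace Ω'] {P : Measure Ω'}
    [IsProbabilityMeasure P] {X : Ω' → ℝ} (hX : IsStandardized X P) {a : ℝ} (ha : 0 < a)
    (h4 : eLpNorm X (ENNReal.ofReal 4) P ≤ ENNReal.ofReal a) :
    1 / (4 * a ^ 4) ≤ (P.map X).real {t | √(1 / 2) ≤ |t|} := by
  have hXm : AEMeasurable X P := hX.memLp.aestronglyMeasurable.aemeasurable
  have hmem : MemLp X (ENNReal.ofReal 4) P :=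
    ⟨hX.memLp.aestronglyMeasurable, h4.trans_lt ENNReal.ofReal_lt_top⟩
  have hint4 : Integrable (fun ω => X ω ^ 4) P := by
    have := hmem.integrable_norm_rpow (by simp) ENNReal.ofReal_ne_top
    rw [ENNReal.toReal_ofReal (by norm_num)] at this
    refine this.congr (Filter.Eventually.of_forall fun ω => ?_)
    change ‖X ω‖ ^ (4 : ℝ) = X ω ^ 4
    rw [show (4 : ℝ) = ((4 : ℕ) : ℝ) by norm_num, Real.rpow_natCast, Real.norm_eq_abs,
      Even.pow_abs ⟨2, rfl⟩]
  have hle : ∫ ω, X ω ^ 4 ∂P ≤ a ^ 4 := by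
    rw [hmem.eLpNorm_eq_integral_rpow_norm (by simp) ENNReal.ofReal_ne_top,
      ENNReal.toReal_ofReal (by norm_num), ENNReal.ofReal_le_ofReal_iff ha.le] at h4
    have h5 : ∫ ω, ‖X ω‖ ^ (4 : ℝ) ∂P = ∫ ω, X ω ^ 4 ∂P := by
      congr 1
      ext ω
      rw [show (4 : ℝ) = ((4 : ℕ) : ℝ) by norm_num, Real.rpow_natCast, Real.norm_eq_abs,
        Even.pow_abs ⟨2, rfl⟩]
    have h0 : 0 ≤ ∫ ω, X ω ^ 4 ∂P := integral_nonneg fun ω => Even.pow_nonneg ⟨2, rfl⟩ _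
    rw [h5, Real.rpow_inv_le_iff_of_pos h0 ha.le (by norm_num)] at h4
    rwa [show (4 : ℝ) = ((4 : ℕ) : ℝ) by norm_num, Real.rpow_natCast] at h4
  have hvar : ∫ ω, X ω ^ 2 ∂P = 1 := by
    rw [← variance_of_integral_eq_zero hXm hX.mean_zero]
    exact hX.unit_variance
  have hpz := paley_zygmund_half (Z := fun ω => X ω ^ 2) (v := 1) (C := a ^ 4)
    hX.memLp.integrable_sq (by simpa only [← pow_mul] using hint4) one_pos (by positivity) hvar
    (by simpa only [← pow_mul, one_pow, mul_one] using hle)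
  rw [map_measureReal_apply_of_aemeasurable hXm (measurableSet_le_abs _)]
  refine hpz.trans (measureReal_mono fun ω hω => ?_)
  have hω' : (1 : ℝ) / 2 ≤ X ω ^ 2 := hω
  change √(1 / 2) ≤ |X ω|
  rw [← Real.sqrt_sq_eq_abs]
  exact Real.sqrt_le_sqrt hω'

/-- The lower tail bound for super-Gaussian variables in explicit form. -/
lemma IsSuperGaussian.le_measureReal_tail {Ω' : Type*} [MeasurableSpace Ω'] {P : Measure Ω'}
    [IsProbabilityMeasure P] {X : Ω' → ℝ} {σ : ℝ} (hX : IsSuperGaussian X σ P) {t : ℝ}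
    (ht : 0 < t) :
    Real.exp (-1) / √(2 * Real.pi) * Real.exp (-(t / σ) ^ 2) ≤
      (P.map X).real {y | t ≤ |y|} := by
  have hσ := hX.parameter_pos
  have hXm : AEMeasurable X P := hX.standardized.memLp.aestronglyMeasurable.aemeasurable
  rw [map_measureReal_apply_of_aemeasurable hXm (measurableSet_le_abs _)]
  refine (exp_le_gaussianReal_tail (div_pos ht hσ).le).trans ?_
  have h1 : (gaussianReal 0 1).real {x | t / σ < x} ≤
      (gaussianReal 0 1).real {x | t < |σ * x|} := by
    refine measureReal_mono fun x hx => ?_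
    have hx' : t / σ < x := hx
    rw [div_lt_iff₀ hσ, mul_comm] at hx'
    exact hx'.trans_le (le_abs_self _)
  refine h1.trans ((ENNReal.toReal_mono (measure_ne_top _ _) (hX.tail_le t ht)).trans ?_)
  exact measureReal_mono fun ω hω => le_of_lt (a := t) (b := |X ω|) hω

/-- Small-ball bound for a single coordinate, from a tail bound for the entries. -/
lemma measureReal_tail_le_two_mul_coordinate {m : ℕ} {ν : Measure ℝ} [IsProbabilityMeasure ν]
    (hν : MeasurePreserving Neg.neg ν ν) {c : ℝ} (hc : 0 ≤ c) (x : ℝ) (z : Fin m → ℝ)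
    (i : Fin m) :
    ν.real {t | c * |x| ≤ |t|} ≤
      2 * (Measure.pi fun _ : Fin m => ν).real {y | c * (x * z i) ≤ z i * y i} := by
  have h1 := measureReal_abs_le_two_mul hν z {i} (c * |x * z i|)
  simp only [Finset.sum_singleton] at h1
  have h2 := (measurePreserving_eval (fun _ : Fin m => ν) i).measureReal_preimage
    (measurableSet_le_abs (c * |x|)).nullMeasurableSet
  rw [← h2]
  have h3 : (Measure.pi fun _ : Fin m => ν).real (Function.eval i ⁻¹' {t | c * |x| ≤ |t|}) ≤
      (Measure.pi fun _ : Fin m => ν).real {y | c * |x * z i| ≤ |z i * y i|} := by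
    refine measureReal_mono fun y hy => ?_
    have hy' : c * |x| ≤ |y i| := hy
    change c * |x * z i| ≤ |z i * y i|
    rw [abs_mul, abs_mul]
    have := mul_le_mul_of_nonneg_left hy' (abs_nonneg (z i))
    linarith
  have h4 : (Measure.pi fun _ : Fin m => ν).real {y | c * |x * z i| ≤ z i * y i} ≤
      (Measure.pi fun _ : Fin m => ν).real {y | c * (x * z i) ≤ z i * y i} := by
    refine measureReal_mono fun y hy => ?_
    have hy' : c * |x * z i| ≤ z i * y i := hy
    exact (mul_le_mul_of_nonneg_left (le_abs_self _) hc).trans hy'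
  linarith

/-- The probability in `small_ball_of_unit_variance` lies in `(0, 1]`. -/
lemma block_probability_bounds (s : ℝ) : 0 < 1 / (16 * max 3 s) ∧ 1 / (16 * max 3 s) ≤ 1 := by
  have h : 3 ≤ max 3 s := le_max_left _ _
  refine ⟨by positivity, ?_⟩
  rw [div_le_one (by positivity)]
  linarith

lemma exp_neg_half_le_of_two_mul_log_le {β R : ℝ} (hβ : 0 < β) (hR : 2 * Real.log β⁻¹ ≤ R) :
    Real.exp (-(R / 2)) ≤ β := by
  rw [← Real.le_log_iff_exp_le hβ]
  rw [Real.log_inv] at hR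
  linarith

/-- The containment for entries with bounded fourth moment. The points of the cube have no large
coordinates, so only blocks of bounded mass occur. -/
theorem exists_constants_of_moment_bound (κ₁ γ : ℝ) (hκ : 0 < κ₁) :
      ∃ C D : ℝ, 0 < C ∧ 0 < D ∧
        ∀ (m N : ℕ) (Ω : Type u) [MeasurableSpace Ω] (μ : Measure Ω) [IsProbabilityMeasure μ]
          (Ω' : Type v) [MeasurableSpace Ω'] (P : Measure Ω') [IsProbabilityMeasure P]
          (A : Ω → Matrix (Fin m) (Fin N) ℝ) (X : Ω' → ℝ),
          0 < m →
          IsIIDSymmetricMatrix A μ X P →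
          IsStandardized X P →
          eLpNorm X (ENNReal.ofReal 4) P ≤ ENNReal.ofReal (κ₁ * 4 ^ γ) →
          C * m ≤ N →
          1 - 2 * Real.exp (-2 * m) ≤
            μ.real {ω | D⁻¹ • ((√(Real.log (Real.exp 1 * N / m)) • lpUnitBall 2 m) ∩
                lpUnitBall ∞ m) ⊆ columnPolytope (A ω)} := by
  set a : ℝ := κ₁ * 4 ^ γ with ha
  have ha0 : 0 < a := by positivity
  set τ : ℝ := √(1 / 2) with hτ
  have hτ0 : 0 < τ := Real.sqrt_pos.2 (by norm_num)
  set q : ℝ := 1 / (8 * a ^ 4) with hq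
  have hq0 : 0 < q := by positivity
  set β : ℝ := 1 / (16 * max 3 (1 / (τ ^ 2 * q ^ 2))) with hβ
  obtain ⟨hβ0, hβ1⟩ := block_probability_bounds (1 / (τ ^ 2 * q ^ 2))
  set R : ℝ := max 1 (2 * Real.log β⁻¹) with hR
  have hR1 : 1 ≤ R := le_max_left _ _
  set α : ℝ := τ * √(q / 2) with hα
  have hα0 : 0 < α := mul_pos hτ0 (Real.sqrt_pos.2 (by positivity))
  have hR0 : 0 < √(2 * R) := Real.sqrt_pos.2 (by linarith)
  refine ⟨Real.exp (80 * Real.exp 1 / β), 2 / (α / √(2 * R)), Real.exp_pos _, by positivity, ?_⟩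
  intro m N Ω _ μ _ Ω' _ P _ A X hm hA hX h4 hN
  obtain ⟨hprob, hneg, hint, hvar⟩ := hA.law hX
  have hsb := small_ball_of_eLpNorm_four_le hX ha0 h4
  have hL := (choose_mul_two_pow_mul_le hm hβ0 hβ1 hN).1
  refine le_measureReal_subset_columnPolytope hm
    (fun j i => (hA.identDistrib j i).aemeasurable_fst)
    (fun j i => (hA.identDistrib j i).map_eq) hA.indep (α := α) (R := R) (by positivity)
    hβ0 hβ1 (by linarith) (exp_neg_half_le_of_two_mul_log_le hβ0 (le_max_right _ _))
    (div_mul_cancel₀ _ hR0.ne').le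
    (fun z I => small_ball_of_unit_variance hneg hint hvar hτ0 hq0 ?_ z I) hN ?_ ?_ ?_
  · refine le_trans (le_of_eq ?_) hsb
    rw [hq]
    field_simp
    norm_num
  · intro j c hc
    refine ⟨single_mem_smul_lpUnitBall hL j hc, mem_lpUnitBall_top_iff.2 fun k => ?_⟩
    rcases eq_or_ne k j with rfl | hk
    · simp [hc]
    · simp [Pi.single_eq_of_ne hk]
  · exact fun x hx => sum_sq_le_of_mem_smul_lpUnitBall (by linarith) hx.1
  · -- Points of the cube have no coordinate of large mass.
    intro x hx z i hxi
    have h1 := mem_lpUnitBall_top_iff.1 hx.2 i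
    have h2 : x i ^ 2 ≤ 1 := (sq_le_one_iff_abs_le_one _).2 h1
    linarith

/-- The containment of a Euclidean ball for super-Gaussian entries. Large coordinates of a point of
the ball form blocks of their own, controlled by the Gaussian lower tail. -/
theorem exists_constants_of_superGaussian (σ : ℝ) (hσ : 0 < σ) :
      ∃ C D : ℝ, 0 < C ∧ 0 < D ∧
        ∀ (m N : ℕ) (Ω : Type u) [MeasurableSpace Ω] (μ : Measure Ω) [IsProbabilityMeasure μ]
          (Ω' : Type v) [MeasurableSpace Ω'] (P : Measure Ω') [IsProbabilityMeasure P]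
          (A : Ω → Matrix (Fin m) (Fin N) ℝ) (X : Ω' → ℝ),
          0 < m →
          IsIIDSymmetricMatrix A μ X P →
          IsSuperGaussian X σ P →
          C * m ≤ N →
          1 - 2 * Real.exp (-2 * m) ≤
            μ.real {ω | (D⁻¹ * √(Real.log (Real.exp 1 * N / m))) • lpUnitBall 2 m ⊆
              columnPolytope (A ω)} := by
  set c : ℝ := Real.exp (-1) / √(2 * Real.pi) with hc
  have hc0 : 0 < c := by positivity
  set q : ℝ := c * Real.exp (-1) / 2 with hq
  have hq0 : 0 < q := by positivity
  set β : ℝ := 1 / (16 * max 3 (1 / (σ ^ 2 * q ^ 2))) with hβ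
  obtain ⟨hβ0, hβ1⟩ := block_probability_bounds (1 / (σ ^ 2 * q ^ 2))
  -- The second lower bound on `R` absorbs the constant `c / 2` of the Gaussian tail.
  set R : ℝ := max 1 (max (2 * Real.log β⁻¹) (4 * Real.log (c / 2)⁻¹)) with hR
  have hR1 : 1 ≤ R := le_max_left _ _
  set α : ℝ := σ * √(q / 2) with hα
  have hα0 : 0 < α := mul_pos hσ (Real.sqrt_pos.2 (by positivity))
  have hR0 : 0 < √(2 * R) := Real.sqrt_pos.2 (by linarith)
  set α' : ℝ := min (α / √(2 * R)) (σ / 2) with hα'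
  have hα'0 : 0 < α' := lt_min (by positivity) (by positivity)
  refine ⟨Real.exp (80 * Real.exp 1 / β), 2 / α', Real.exp_pos _, by positivity, ?_⟩
  intro m N Ω _ μ _ Ω' _ P _ A X hm hA hX hN
  obtain ⟨hprob, hneg, hint, hvar⟩ := hA.law hX.standardized
  have hL := (choose_mul_two_pow_mul_le hm hβ0 hβ1 hN).1
  simp only [mul_smul]
  refine le_measureReal_subset_columnPolytope hm
    (fun j i => (hA.identDistrib j i).aemeasurable_fst)
    (fun j i => (hA.identDistrib j i).map_eq) hA.indep (α := α) (R := R) hα'0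
    hβ0 hβ1 (by linarith)
    (exp_neg_half_le_of_two_mul_log_le hβ0 ((le_max_left _ _).trans (le_max_right _ _)))
    ((le_div_iff₀ hR0).1 (min_le_left _ _))
    (fun z I => small_ball_of_unit_variance hneg hint hvar hσ hq0 ?_ z I) hN
    (fun j c hc => single_mem_smul_lpUnitBall hL j hc)
    (fun x hx => sum_sq_le_of_mem_smul_lpUnitBall (by linarith) hx) ?_
  · have h1 := hX.le_measureReal_tail hσ
    rw [div_self hσ.ne', one_pow] at h1
    rw [hq]
    linarith
  · intro x _ z i hxi
    have hx0 : 0 < |x i| := abs_pos.2 fun h => by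
      rw [h] at hxi
      norm_num at hxi
      linarith
    have h1 := hX.le_measureReal_tail (mul_pos hα'0 hx0)
    have h2 := h1.trans (measureReal_tail_le_two_mul_coordinate hneg hα'0.le (x i) z i)
    have h3 : (α' * |x i| / σ) ^ 2 ≤ x i ^ 2 / 4 := by
      have h4 : α' / σ ≤ 1 / 2 := by
        rw [div_le_iff₀ hσ]
        exact (min_le_right _ _).trans (by linarith)
      have h5 : (α' / σ) ^ 2 ≤ (1 / 2) ^ 2 := pow_le_pow_left₀ (by positivity) h4 2
      calc (α' * |x i| / σ) ^ 2 = (α' / σ) ^ 2 * x i ^ 2 := by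
            rw [← sq_abs (x i)]
            ring
        _ ≤ (1 / 2) ^ 2 * x i ^ 2 := mul_le_mul_of_nonneg_right h5 (sq_nonneg _)
        _ = x i ^ 2 / 4 := by ring
    have h6 : Real.exp (-(x i ^ 2 / 4)) ≤ c / 2 := by
      rw [← Real.le_log_iff_exp_le (by positivity)]
      have h7 : 4 * Real.log (c / 2)⁻¹ ≤ R := (le_max_right _ _).trans (le_max_right _ _)
      rw [Real.log_inv] at h7
      linarith
    have h8 : Real.exp (-(x i ^ 2 / 4)) ≤ Real.exp (-(α' * |x i| / σ) ^ 2) :=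
      Real.exp_le_exp.2 (by linarith)
    have h9 : Real.exp (-(x i ^ 2 / 2)) ≤ c / 2 * Real.exp (-(α' * |x i| / σ) ^ 2) := by
      calc Real.exp (-(x i ^ 2 / 2)) =
            Real.exp (-(x i ^ 2 / 4)) * Real.exp (-(x i ^ 2 / 4)) := by
            rw [← Real.exp_add]
            congr 1
            ring
        _ ≤ _ := mul_le_mul h6 h8 (Real.exp_pos _).le (by positivity)
    linarith

theorem corollary2p5 :
    (∃ c₀ : ℝ, 0 < c₀ ∧ ∀ κ₁ γ : ℝ, 0 < κ₁ → 1 / 2 ≤ γ →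
      ∃ C D : ℝ, 0 < C ∧ 0 < D ∧
        ∀ (m N : ℕ) (Ω : Type u) [MeasurableSpace Ω] (μ : Measure Ω) [IsProbabilityMeasure μ]
          (Ω' : Type v) [MeasurableSpace Ω'] (P : Measure Ω') [IsProbabilityMeasure P]
          (A : Ω → Matrix (Fin m) (Fin N) ℝ) (X : Ω' → ℝ),
          0 < m →
          IsIIDSymmetricMatrix A μ X P →
          WeakMomentAssumption X (max 4 (Real.log m)) κ₁ γ P →
          4 * Real.exp (4 * γ) * c₀ ^ 2 * κ₁ ^ 2 * Real.log m ≤ m →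
          max (C * m) (Real.log m ^ (2 * γ - 1)) ≤ N →
          1 - 2 * Real.exp (-2 * m) ≤
            μ.real {ω | D⁻¹ • ((√(Real.log (Real.exp 1 * N / m)) • lpUnitBall 2 m) ∩
                lpUnitBall ∞ m) ⊆ columnPolytope (A ω)}) ∧
    (∀ σ : ℝ, 0 < σ → σ ≤ 1 →
      ∃ C D : ℝ, 0 < C ∧ 0 < D ∧
        ∀ (m N : ℕ) (Ω : Type u) [MeasurableSpace Ω] (μ : Measure Ω) [IsProbabilityMeasure μ]
          (Ω' : Type v) [MeasurableSpace Ω'] (P : Measure Ω') [IsProbabilityMeasure P]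
          (A : Ω → Matrix (Fin m) (Fin N) ℝ) (X : Ω' → ℝ),
          0 < m →
          IsIIDSymmetricMatrix A μ X P →
          IsSuperGaussian X σ P →
          C * m ≤ N →
          1 - 2 * Real.exp (-2 * m) ≤
            μ.real {ω | (D⁻¹ * √(Real.log (Real.exp 1 * N / m))) • lpUnitBall 2 m ⊆
              columnPolytope (A ω)}) := by
  refine ⟨⟨1, one_pos, fun κ₁ γ hκ hγ => ?_⟩, fun σ hσ _ =>
    exists_constants_of_superGaussian σ hσ⟩
  obtain ⟨C, D, hC, hD, h⟩ := exists_constants_of_moment_bound κ₁ γ hκ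
  refine ⟨C, D, hC, hD, ?_⟩
  intro m N Ω _ μ _ Ω' _ P _ A X hm hA hX _ hN
  exact h m N Ω μ Ω' P A X hm hA hX.standardized (hX.moment_le 4 le_rfl (le_max_left _ _))
    ((le_max_left _ _).trans hN)
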